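/- \textbf{Setting.} Let $d\ge 0$ and consider the linear regression $y_t=\theta'x_t+\varepsilon_t$, $t=1,2,\dots$, with $x_t\in\mathbb R^{1+d}$ and $\theta=(\gamma,\beta')'\in\Theta=[0,\infty)^{1+d}$; write $W_t=(y_t,x_t')'$ and $\Theta_{0}=\{\theta\in\Theta:\gamma=0\}$. The distribution of the data is determined by $\psi=(\theta,\phi)\in\Psi=\{(\theta,\phi):\theta\in\Theta,\ \phi\in\Phi(\theta)\}$, where $\Phi(\theta)\subset\Phi$ and $\Phi$ is a compact metric space which induces weak convergence of the bivariate distributions: if $\psi_n\to\psi_0$ in $\Psi$, then for all $t,s\ge1$ the distribution of $(W_t,W_{t+s})$ under $\psi_n$ converges weakly to that under $\psi_0$. Fix $\kappa>0$ and let $\Upsilon$ be the set of positive definite $(1+d)\times(1+d)$ matrices with all eigenvalues in $[\kappa,\kappa^{-1}]$. Let $$L_n(\theta)=-\tfrac12\sum_{t=1}^n (y_t-x_t'\theta)^2,$$ and let $\hat\theta_n$ and $\tilde\theta_n$ be any maximizers of $L_n$ over $\Theta$ and over $\Theta_{0}$, respectively. Derivatives of $L_n$ on $\Theta$ are left/right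 partial derivatives, that is, with respect to perturbations of one coordinate that stay in $\Theta$. \textbf{Assumption (LinIID).} For all $\psi\in\Psi$: (1) $\{(x_t',\varepsilon_t)'\}_{t\ge1}$ are i.i.d. with $\mathbb E_\psi[\varepsilon_t\mid x_t]=0$ almost surely; (2) $\mathbb E_\psi[x_tx_t']\in\Upsilon$ and $\mathbb E_\psi[x_tx_t'\varepsilon_t^2]\in\Upsilon$; (3) $\mathbb E_\psi|x_{j,t}|^{2+\nu}\le c$ and $\mathbb E_\psi|x_{j,t}\varepsilon_t|^{2+\nu}\le c$ for every component $j=1,\dots,1+d$ of $x_t$, with constants $c<\infty$ and $\nu>0$ that do not depend on $\psi$. \textbf{Proposition.} Suppose that Assumption (LinIID) holds. Let $\psi_n=(\theta_n,\phi_n)\in\Psi$ be any sequence with $\theta_n=(0,\beta_n')'\in\Theta_{0}$, $\psi_n\to\psi_0=(\theta_0,\phi_0)\in\Psi$ and $\sqrt n\,\beta_n\to b\in[0,\infty]^{d}$. Put $\Omega_0=\mathbb E_{\psi_0}[x_tx_t']$ and $\Sigma_0=\mathbb E_{\psi_0}[x_tx_t'\varepsilon_t^2]$. Then, as $n\to\infty$,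 with the data of sample size $n$ distributed according to $\psi_n$: \begin{enumerate} \item $\hat\theta_n-\theta_n=o_p(1)$ and $\tilde\theta_n-\theta_n=o_p(1)$; \item (i) for all $n\ge1$, almost surely, $L_n$ has continuous left/right partial derivatives of order two on $\Theta$; (ii) for all deterministic $\epsilon_n\to0$, $$\sup_{\theta\in\Theta:\,\|\theta-\theta_n\|\le\epsilon_n}\left\|n^{-1}\frac{\partial^2L_n(\theta)}{\partial\theta\,\partial\theta'}-n^{-1}\frac{\partial^2L_n(\theta_n)}{\partial\theta\,\partial\theta'}\right\|=o_p(1);$$ \item $n^{-1}\,\partial^2L_n(\theta_n)/\partial\theta\,\partial\theta'\overset{p}{\to}-\Omega_0$, with $\Omega_0\in\Upsilon$; \item $n^{-1/2}\,\partial L_n(\theta_n)/\partial\theta\overset{d}{\to}N(0,\Sigma_0)$, with $\Sigma_0\in\Upsilon$. \end{enumerate} -/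

import Mathlib

open MeasureTheory ProbabilityTheory Filter Topology
open scoped ENNReal Matrix.Norms.Frobenius

/-! ### Stochastic convergence and one-sided derivatives -/

/-- `X n = o_p(1)` under `μ n`, for `[0, ∞]`-valued `X n` (norms of random vectors or matrices,
or suprema of such). -/
def TendstoZeroInProbability {Ω : Type*} [MeasurableSpace Ω] (μ : ℕ → Measure Ω)
    (X : ℕ → Ω → ℝ≥0∞) : Prop :=
  ∀ δ : ℝ≥0∞, 0 < δ → Tendsto (fun n => μ n {ω | δ ≤ X n ω}) atTop (𝓝 0)

/-- The left/right partial derivative of order one of `f` on `Θ` with respect to the `i`-th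
coordinate: only perturbations of the `i`-th coordinate that stay in `Θ` are used, so that it is
the two-sided partial derivative where the coordinate can be moved both ways, and the left or
right one where it can be moved one way only. -/
noncomputable def lrPartial {k : ℕ} (Θ : Set (EuclideanSpace ℝ (Fin k))) (i : Fin k)
    (f : EuclideanSpace ℝ (Fin k) → ℝ) (θ : EuclideanSpace ℝ (Fin k)) : ℝ :=
  lineDerivWithin ℝ f Θ θ (EuclideanSpace.single i 1)

/-- Existence of the left/right partial derivative of `f` on `Θ` at `θ`, `i`-th coordinate. -/
def HasLRPartial {k : ℕ} (Θ : Set (EuclideanSpace ℝ (Fin k))) (i : Fin k)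
    (f : EuclideanSpace ℝ (Fin k) → ℝ) (θ : EuclideanSpace ℝ (Fin k)) : Prop :=
  LineDifferentiableWithinAt ℝ f Θ θ (EuclideanSpace.single i 1)

/-- The score `∂f(θ)/∂θ`. -/
noncomputable def lrGradient {k : ℕ} (Θ : Set (EuclideanSpace ℝ (Fin k)))
    (f : EuclideanSpace ℝ (Fin k) → ℝ) (θ : EuclideanSpace ℝ (Fin k)) :
    EuclideanSpace ℝ (Fin k) :=
  WithLp.toLp 2 fun i => lrPartial Θ i f θ

/-- The Hessian `∂²f(θ)/∂θ∂θ'`. -/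
noncomputable def lrHessian {k : ℕ} (Θ : Set (EuclideanSpace ℝ (Fin k)))
    (f : EuclideanSpace ℝ (Fin k) → ℝ) (θ : EuclideanSpace ℝ (Fin k)) :
    Matrix (Fin k) (Fin k) ℝ :=
  Matrix.of fun i j => lrPartial Θ j (lrPartial Θ i f) θ

/-- `f` has continuous left/right partial derivatives of order two on `Θ`. -/
def HasContinuousLRPartialsTwo {k : ℕ} (Θ : Set (EuclideanSpace ℝ (Fin k)))
    (f : EuclideanSpace ℝ (Fin k) → ℝ) : Prop :=
  (∀ i, (∀ θ ∈ Θ, HasLRPartial Θ i f θ) ∧ ContinuousOn (lrPartial Θ i f) Θ) ∧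
  ∀ i j, (∀ θ ∈ Θ, HasLRPartial Θ j (lrPartial Θ i f) θ) ∧
    ContinuousOn (lrPartial Θ j (lrPartial Θ i f)) Θ

/-- The set `Υ` of positive definite matrices with eigenvalues in `[κ, κ⁻¹]`. -/
def boundedPosDef (k : ℕ) (κ : ℝ) : Set (Matrix (Fin k) (Fin k) ℝ) :=
  {A | A.PosDef ∧
    ∀ μ : ℝ, Module.End.HasEigenvalue (Matrix.toLin' A) μ → κ ≤ μ ∧ μ ≤ κ⁻¹}

/-! ### The four high-level conditions

`μ n` is the distribution of the data at the `n`-th element of the drifting sequence, `θ n` the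
true parameter there, and `L n ω` the objective function computed from the first `n`
observations. -/

/-- The set of maximizers of `f` over `S`. -/
def argmaxSet {E : Type*} (f : E → ℝ) (S : Set E) : Set E :=
  {θ | θ ∈ S ∧ ∀ θ' ∈ S, f θ' ≤ f θ}

/-- `T n` is a maximizer of `L n` over `S` for every sample for which there is one. On samples
without a maximizer `T n` is arbitrary, so that a consistency claim about all such `T` contains
the existence of maximizers with probability approaching one. -/
def IsMaximumEstimator {Ω E : Type*} (L : ℕ → Ω → E → ℝ) (S : Set E) (T : ℕ → Ω → E) : Prop :=
  ∀ n ω, (argmaxSet (L n ω) S).Nonempty → T n ω ∈ argmaxSet (L n ω) S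

/-- Consistency of the unrestricted (over `Θ`) and the restricted (over `Θ₀`) estimators. -/
def ConsistencyCondition {Ω : Type*} [MeasurableSpace Ω] {k : ℕ} (μ : ℕ → Measure Ω)
    (L : ℕ → Ω → EuclideanSpace ℝ (Fin k) → ℝ) (Θ Θ₀ : Set (EuclideanSpace ℝ (Fin k)))
    (θ : ℕ → EuclideanSpace ℝ (Fin k)) : Prop :=
  (∀ θhat, IsMaximumEstimator L Θ θhat →
    TendstoZeroInProbability μ fun n ω => ‖θhat n ω - θ n‖ₑ) ∧
  (∀ θtilde, IsMaximumEstimator L Θ₀ θtilde →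
    TendstoZeroInProbability μ fun n ω => ‖θtilde n ω - θ n‖ₑ)

/-- Smoothness of the objective function: (i) continuous left/right partial derivatives of order
two, almost surely; (ii) equicontinuity of the normalized Hessian at `θ n`. -/
def DerivativesCondition {Ω : Type*} [MeasurableSpace Ω] {k : ℕ} (μ : ℕ → Measure Ω)
    (L : ℕ → Ω → EuclideanSpace ℝ (Fin k) → ℝ) (Θ : Set (EuclideanSpace ℝ (Fin k)))
    (θ : ℕ → EuclideanSpace ℝ (Fin k)) : Prop :=
  (∀ n, 1 ≤ n → ∀ᵐ ω ∂(μ n), HasContinuousLRPartialsTwo Θ (L n ω)) ∧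
  ∀ r : ℕ → ℝ, Tendsto r atTop (𝓝 0) →
    TendstoZeroInProbability μ fun n ω =>
      ⨆ ϑ ∈ {ϑ | ϑ ∈ Θ ∧ ‖ϑ - θ n‖ ≤ r n},
        ‖(n : ℝ)⁻¹ • lrHessian Θ (L n ω) ϑ - (n : ℝ)⁻¹ • lrHessian Θ (L n ω) (θ n)‖ₑ

/-- The normalized Hessian at `θ n` converges in probability to `-Ω₀`, with `Ω₀ ∈ Υ`. -/
def HessianCondition {Ω : Type*} [MeasurableSpace Ω] {k : ℕ} (μ : ℕ → Measure Ω)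
    (L : ℕ → Ω → EuclideanSpace ℝ (Fin k) → ℝ) (Θ : Set (EuclideanSpace ℝ (Fin k)))
    (θ : ℕ → EuclideanSpace ℝ (Fin k)) (Υ : Set (Matrix (Fin k) (Fin k) ℝ))
    (Ω₀ : Matrix (Fin k) (Fin k) ℝ) : Prop :=
  TendstoZeroInProbability μ (fun n ω => ‖(n : ℝ)⁻¹ • lrHessian Θ (L n ω) (θ n) - (-Ω₀)‖ₑ) ∧
  Ω₀ ∈ Υ

/-- The normalized score at `θ n` converges in distribution to `N(0, V₀)`, with `V₀ ∈ Υ`. -/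
def ScoreCondition {Ω : Type*} [MeasurableSpace Ω] {k : ℕ} (μ : ℕ → ProbabilityMeasure Ω)
    (L : ℕ → Ω → EuclideanSpace ℝ (Fin k) → ℝ) (Θ : Set (EuclideanSpace ℝ (Fin k)))
    (θ : ℕ → EuclideanSpace ℝ (Fin k)) (Υ : Set (Matrix (Fin k) (Fin k) ℝ))
    (V₀ : Matrix (Fin k) (Fin k) ℝ) : Prop :=
  TendstoInDistribution (fun (n : ℕ) ω => (√(n : ℝ))⁻¹ • lrGradient Θ (L n ω) (θ n)) atTop
    (id : EuclideanSpace ℝ (Fin k) → EuclideanSpace ℝ (Fin k))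
    (fun n => (μ n : Measure Ω)) (multivariateGaussian 0 V₀) ∧
  V₀ ∈ Υ

/-! ### The regression model -/

/-- The parameter space `Θ = [0, ∞)^{1+d}` of `θ = (γ, β')'`; coordinate `0` is `γ`, and the
coordinate `j.succ` is `β_j`. -/
def paramSpace (d : ℕ) : Set (EuclideanSpace ℝ (Fin (d + 1))) :=
  {θ | ∀ i, 0 ≤ θ i}

/-- The parameter space under the null hypothesis `γ = 0`. -/
def nullParamSpace (d : ℕ) : Set (EuclideanSpace ℝ (Fin (d + 1))) :=
  {θ | θ ∈ paramSpace d ∧ θ 0 = 0}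

/-- The statistical model. The observations are `W_t = (y_t, x_t')'`; their index `t` starts at
`0`, so that a sample of size `n` consists of those with `t < n`. The parameter is `ψ = (θ, φ)`,
`admissible θ` is the set of those `φ` that are allowed together with `θ`, and `P ψ` is the
distribution under `ψ`. -/
structure RegressionModel (d : ℕ) (Φ Ω : Type*) [MeasurableSpace Ω] where
  y : ℕ → Ω → ℝ
  x : ℕ → Ω → EuclideanSpace ℝ (Fin (d + 1))
  measurable_y : ∀ t, Measurable (y t)
  measurable_x : ∀ t, Measurable (x t)
  admissible : EuclideanSpace ℝ (Fin (d + 1)) → Set Φ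
  P : EuclideanSpace ℝ (Fin (d + 1)) × Φ → ProbabilityMeasure Ω

namespace RegressionModel

variable {d : ℕ} {Φ Ω : Type*} [MeasurableSpace Ω] (M : RegressionModel d Φ Ω)

/-- The space `Ψ` of the parameters `ψ = (θ, φ)`. -/
def fullParamSpace : Set (EuclideanSpace ℝ (Fin (d + 1)) × Φ) :=
  {ψ | ψ.1 ∈ paramSpace d ∧ ψ.2 ∈ M.admissible ψ.1}

/-- The regression error `ε_t = y_t - θ'x_t`. -/
noncomputable def err (θ : EuclideanSpace ℝ (Fin (d + 1))) (t : ℕ) (ω : Ω) : ℝ :=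
  M.y t ω - ∑ i, θ i * M.x t ω i

/-- The least-squares objective function `L_n(θ) = -½ ∑_t (y_t - x_t'θ)²`. -/
noncomputable def objective (n : ℕ) (ω : Ω) (θ : EuclideanSpace ℝ (Fin (d + 1))) : ℝ :=
  -(1 / 2) * ∑ t ∈ Finset.range n, (M.y t ω - ∑ i, M.x t ω i * θ i) ^ 2

/-- `E_ψ[x_t x_t']`. -/
noncomputable def regressorMoment (ψ : EuclideanSpace ℝ (Fin (d + 1)) × Φ) (t : ℕ) :
    Matrix (Fin (d + 1)) (Fin (d + 1)) ℝ :=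
  Matrix.of fun i j => ∫ ω, M.x t ω i * M.x t ω j ∂(M.P ψ : Measure Ω)

/-- `E_ψ[x_t x_t' ε_t²]`. -/
noncomputable def scoreMoment (ψ : EuclideanSpace ℝ (Fin (d + 1)) × Φ) (t : ℕ) :
    Matrix (Fin (d + 1)) (Fin (d + 1)) ℝ :=
  Matrix.of fun i j =>
    ∫ ω, M.x t ω i * M.x t ω j * M.err ψ.1 t ω ^ 2 ∂(M.P ψ : Measure Ω)

/-- The topology of the parameter space induces weak convergence of the bivariate distributions
of `(W_t, W_{t+s})`: if `ψ n → ψ₀` in `Ψ`, then these distributions converge weakly. -/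
def InducesWeakConvergence [TopologicalSpace Φ] : Prop :=
  ∀ (ψ : ℕ → EuclideanSpace ℝ (Fin (d + 1)) × Φ) (ψ₀ : EuclideanSpace ℝ (Fin (d + 1)) × Φ),
    (∀ n, ψ n ∈ M.fullParamSpace) → ψ₀ ∈ M.fullParamSpace → Tendsto ψ atTop (𝓝 ψ₀) →
    ∀ t s : ℕ, 1 ≤ s →
      TendstoInDistribution
        (fun (_ : ℕ) ω => ((M.y t ω, M.x t ω), (M.y (t + s) ω, M.x (t + s) ω))) atTop
        (fun ω => ((M.y t ω, M.x t ω), (M.y (t + s) ω, M.x (t + s) ω)))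
        (fun n => (M.P (ψ n) : Measure Ω)) (M.P ψ₀ : Measure Ω)

/-- The assumption on the i.i.d. linear regression model, for all `ψ ∈ Ψ`: (1) the `(x_t', ε_t)'`
are i.i.d. with `E_ψ[ε_t | x_t] = 0` almost surely; (2) `E_ψ[x_t x_t'] ∈ Υ` and
`E_ψ[x_t x_t' ε_t²] ∈ Υ`; (3) `E_ψ|x_{j,t}|^{2+ν} ≤ c` and `E_ψ|x_{j,t} ε_t|^{2+ν} ≤ c` with
constants `c < ∞` and `ν > 0` that do not depend on `ψ`. -/
def LinIID (κ : ℝ) : Prop :=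
  (∀ ψ ∈ M.fullParamSpace,
    iIndepFun (fun t ω => (M.x t ω, M.err ψ.1 t ω)) (M.P ψ : Measure Ω) ∧
    (∀ t, IdentDistrib (fun ω => (M.x t ω, M.err ψ.1 t ω)) (fun ω => (M.x 0 ω, M.err ψ.1 0 ω))
      (M.P ψ : Measure Ω) (M.P ψ : Measure Ω)) ∧
    (∀ t, Integrable (M.err ψ.1 t) (M.P ψ : Measure Ω) ∧
      (M.P ψ : Measure Ω)[M.err ψ.1 t | MeasurableSpace.comap (M.x t) inferInstance]
        =ᵐ[(M.P ψ : Measure Ω)] 0)) ∧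
  (∀ ψ ∈ M.fullParamSpace, ∀ t,
    M.regressorMoment ψ t ∈ boundedPosDef (d + 1) κ ∧
    M.scoreMoment ψ t ∈ boundedPosDef (d + 1) κ) ∧
  ∃ c ν : ℝ, 0 < ν ∧ ∀ ψ ∈ M.fullParamSpace, ∀ (t : ℕ) (j : Fin (d + 1)),
    ∫⁻ ω, ENNReal.ofReal (|M.x t ω j| ^ (2 + ν)) ∂(M.P ψ : Measure Ω) ≤ ENNReal.ofReal c ∧
    ∫⁻ ω, ENNReal.ofReal (|M.x t ω j * M.err ψ.1 t ω| ^ (2 + ν)) ∂(M.P ψ : Measure Ω)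
      ≤ ENNReal.ofReal c

/-- `ψ n = (θ n, φ n)` is a drifting sequence in `Ψ` along which the null hypothesis holds:
`ψ n → ψ₀ ∈ Ψ` and `√n β_n → b ∈ [0, ∞]^d`. -/
def IsDrifting [TopologicalSpace Φ] (ψ : ℕ → EuclideanSpace ℝ (Fin (d + 1)) × Φ)
    (ψ₀ : EuclideanSpace ℝ (Fin (d + 1)) × Φ) (b : Fin d → ℝ≥0∞) : Prop :=
  (∀ n, ψ n ∈ M.fullParamSpace ∧ (ψ n).1 ∈ nullParamSpace d) ∧
  ψ₀ ∈ M.fullParamSpace ∧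
  Tendsto ψ atTop (𝓝 ψ₀) ∧
  ∀ j : Fin d, Tendsto (fun n : ℕ => ENNReal.ofReal (√(n : ℝ) * (ψ n).1 j.succ)) atTop (𝓝 (b j))

end RegressionModel

/-! ### Moment bounds and truncation -/

/-! The objective is quadratic in the parameter, so its second-order expansion is an identity
(`objective_add`). On `paramSpace d` its one-sided Hessian is minus the Gram matrix, which does not
depend on the parameter; smoothness and equicontinuity are then immediate. What remains is a law of
large numbers for the Gram matrix and the score, and a central limit theorem for the score, both for
triangular arrays, since the law of the data changes with `n`.

Moments converge along the sequence because weak convergence of the observations and a uniform bound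
on moments of order `1 + δ` give convergence of expectations. The error involves the moving
parameter, which is handled by `continuous_comp_param`. Products of two regressors have only `1 + ν
/ 2` moments, so `integral_abs_average_sub_le` truncates before using the variance. The central
limit theorem follows from a Taylor bound on characteristic functions (`norm_exp_I_sub_taylor_le`,
`tendsto_integral_exp_pow`).

For consistency, once the normalized Gram matrix is close to its positive definite limit,
`objective_add_le` bounds increments of the objective by a negative definite quadratic plus a linear
term of the size of the normalized score. This gives existence of maximizers on any nonempty closed
set, and a bound on their distance to the true parameter by a multiple of the normalized score,
which tends to zero. -/

lemma rpow_le_one_add_rpow {x p q : ℝ} (hx : 0 ≤ x) (hp : 0 ≤ p) (hpq : p ≤ q) :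
    x ^ p ≤ 1 + x ^ q := by
  rcases le_total x 1 with h | h
  · have := Real.rpow_le_one hx h hp
    have := Real.rpow_nonneg hx q
    linarith
  · have := Real.rpow_le_rpow_of_exponent_le h hpq
    linarith

/-- The truncation of a real number to the interval `[-K, K]`. -/
noncomputable def clipReal (K x : ℝ) : ℝ := max (-K) (min x K)

lemma continuous_clipReal (K : ℝ) : Continuous (clipReal K) := by
  unfold clipReal; fun_prop

lemma abs_clipReal_le {K : ℝ} (hK : 0 ≤ K) (x : ℝ) : |clipReal K x| ≤ K := by
  unfold clipReal
  rw [abs_le]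
  exact ⟨le_max_left _ _, max_le (by linarith) (min_le_right _ _)⟩

/-- The difference vanishes for `|x| ≤ K`; otherwise it is at most `|x| ≤ |x| * (|x| / K) ^ δ`. -/
lemma abs_sub_clipReal_le {K δ : ℝ} (hK : 0 < K) (hδ : 0 < δ) (x : ℝ) :
    |x - clipReal K x| ≤ |x| ^ (1 + δ) * K ^ (-δ) := by
  rcases le_or_gt |x| K with h | h
  · have hx := abs_le.1 h
    have : clipReal K x = x := by
      unfold clipReal
      rw [min_eq_left hx.2, max_eq_right hx.1]
    rw [this, sub_self, abs_zero]
    positivity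
  · have h1 : |x - clipReal K x| ≤ |x| := by
      unfold clipReal
      rcases abs_cases x with ⟨h2, h3⟩ | ⟨h2, h3⟩
      · rw [min_eq_right (by linarith), max_eq_right (by linarith), abs_le]
        constructor <;> linarith
      · rw [min_eq_left (by linarith), max_eq_left (by linarith), abs_le]
        constructor <;> linarith
    refine h1.trans ?_
    have hx : 0 < |x| := hK.trans h
    rw [Real.rpow_add hx, Real.rpow_one, mul_assoc, Real.rpow_neg hK.le]
    refine le_mul_of_one_le_right hx.le ?_
    rw [← div_eq_mul_inv, one_le_div (by positivity)]
    exact Real.rpow_le_rpow hK.le h.le hδ.le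

section Moments

variable {Ω : Type*} [MeasurableSpace Ω] {μ : Measure Ω}

lemma integrable_abs_rpow_of_le [IsFiniteMeasure μ] {X : Ω → ℝ} {p q : ℝ} (hX : AEMeasurable X μ)
    (hp : 0 ≤ p) (hpq : p ≤ q) (h : Integrable (fun ω => |X ω| ^ q) μ) :
    Integrable (fun ω => |X ω| ^ p) μ := by
  refine Integrable.mono' ((integrable_const (1 : ℝ)).add h) ?_ (ae_of_all _ fun ω => ?_)
  · exact (hX.abs.pow_const p).aestronglyMeasurable
  · rw [Real.norm_of_nonneg (by positivity)]
    exact rpow_le_one_add_rpow (abs_nonneg _) hp hpq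

lemma integrable_of_integrable_abs_rpow [IsFiniteMeasure μ] {X : Ω → ℝ} {q : ℝ}
    (hX : AEMeasurable X μ) (hq : 1 ≤ q) (h : Integrable (fun ω => |X ω| ^ q) μ) :
    Integrable X μ := by
  have := integrable_abs_rpow_of_le hX zero_le_one hq h
  simp only [Real.rpow_one] at this
  exact (integrable_norm_iff hX.aestronglyMeasurable).1 this

lemma integrable_abs_rpow_of_lintegral_le {X : Ω → ℝ} {q c : ℝ} (hX : AEMeasurable X μ)
    (h : ∫⁻ ω, ENNReal.ofReal (|X ω| ^ q) ∂μ ≤ ENNReal.ofReal c) :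
    Integrable (fun ω => |X ω| ^ q) μ := by
  refine ⟨(hX.abs.pow_const q).aestronglyMeasurable, ?_⟩
  rw [hasFiniteIntegral_iff_ofReal (ae_of_all _ fun ω => by positivity)]
  exact h.trans_lt ENNReal.ofReal_lt_top

/-- The maximum with `0` appears because `ENNReal.ofReal c` is `0` for negative `c`. -/
lemma integral_abs_rpow_le_of_lintegral_le {X : Ω → ℝ} {q c : ℝ} (hX : AEMeasurable X μ)
    (h : ∫⁻ ω, ENNReal.ofReal (|X ω| ^ q) ∂μ ≤ ENNReal.ofReal c) :
    ∫ ω, |X ω| ^ q ∂μ ≤ max c 0 := by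
  rw [integral_eq_lintegral_of_nonneg_ae (ae_of_all _ fun ω => by positivity)
    (hX.abs.pow_const q).aestronglyMeasurable]
  refine ENNReal.toReal_le_of_le_ofReal (le_max_right _ _) (h.trans ?_)
  exact ENNReal.ofReal_le_ofReal (le_max_left _ _)

/-- The arithmetic-geometric mean inequality for `|x| ^ (p / 2)` and `|y| ^ (p / 2)`. With `p = 2 +
ν` it turns moment bounds on two factors into one of order `1 + ν / 2` on their product. -/
lemma abs_mul_rpow_half_le (x y p : ℝ) :
    |x * y| ^ (p / 2) ≤ (|x| ^ p + |y| ^ p) / 2 := by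
  have h : ∀ z : ℝ, |z| ^ p = (|z| ^ (p / 2)) ^ 2 := fun z => by
    rw [← Real.rpow_mul_natCast (abs_nonneg z)]
    congr 1
    push_cast
    ring
  rw [abs_mul, Real.mul_rpow (abs_nonneg _) (abs_nonneg _), h x, h y]
  nlinarith [sq_nonneg (|x| ^ (p / 2) - |y| ^ (p / 2))]

lemma integrable_abs_mul_rpow_half {X Y : Ω → ℝ} {p : ℝ} (hX : AEMeasurable X μ)
    (hY : AEMeasurable Y μ) (hXp : Integrable (fun ω => |X ω| ^ p) μ)
    (hYp : Integrable (fun ω => |Y ω| ^ p) μ) :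
    Integrable (fun ω => |X ω * Y ω| ^ (p / 2)) μ := by
  refine Integrable.mono' ((hXp.add hYp).div_const 2) ?_ (ae_of_all _ fun ω => ?_)
  · exact ((hX.mul hY).abs.pow_const _).aestronglyMeasurable
  · rw [Real.norm_of_nonneg (by positivity)]
    exact abs_mul_rpow_half_le _ _ _

lemma integral_abs_mul_rpow_half_le {X Y : Ω → ℝ} {p C : ℝ} (hX : AEMeasurable X μ)
    (hY : AEMeasurable Y μ) (hXp : Integrable (fun ω => |X ω| ^ p) μ)
    (hYp : Integrable (fun ω => |Y ω| ^ p) μ) (hXC : ∫ ω, |X ω| ^ p ∂μ ≤ C)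
    (hYC : ∫ ω, |Y ω| ^ p ∂μ ≤ C) :
    ∫ ω, |X ω * Y ω| ^ (p / 2) ∂μ ≤ C := by
  calc ∫ ω, |X ω * Y ω| ^ (p / 2) ∂μ ≤ ∫ ω, (|X ω| ^ p + |Y ω| ^ p) / 2 ∂μ :=
        integral_mono (integrable_abs_mul_rpow_half hX hY hXp hYp)
          ((hXp.add hYp).div_const 2) fun ω => abs_mul_rpow_half_le _ _ _
    _ = (∫ ω, |X ω| ^ p ∂μ + ∫ ω, |Y ω| ^ p ∂μ) / 2 := by
        rw [integral_div, integral_add hXp hYp]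
    _ ≤ C := by linarith

lemma integrable_clipReal [IsFiniteMeasure μ] {X : Ω → ℝ} {K : ℝ} (hK : 0 ≤ K)
    (hX : AEMeasurable X μ) : Integrable (fun ω => clipReal K (X ω)) μ :=
  Integrable.of_bound ((continuous_clipReal K).measurable.comp_aemeasurable hX).aestronglyMeasurable
    K (ae_of_all _ fun _ => abs_clipReal_le hK _)

lemma integral_abs_sub_clipReal_le [IsFiniteMeasure μ] {X : Ω → ℝ} {K δ C : ℝ} (hK : 0 < K)
    (hδ : 0 < δ) (hX : AEMeasurable X μ) (h : Integrable (fun ω => |X ω| ^ (1 + δ)) μ)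
    (hC : ∫ ω, |X ω| ^ (1 + δ) ∂μ ≤ C) :
    ∫ ω, |X ω - clipReal K (X ω)| ∂μ ≤ C * K ^ (-δ) := by
  have hint := integrable_of_integrable_abs_rpow hX (by linarith) h
  calc ∫ ω, |X ω - clipReal K (X ω)| ∂μ ≤ ∫ ω, |X ω| ^ (1 + δ) * K ^ (-δ) ∂μ :=
        integral_mono (hint.sub (integrable_clipReal hK.le hX)).abs (h.mul_const _)
          fun ω => abs_sub_clipReal_le hK hδ _
    _ = (∫ ω, |X ω| ^ (1 + δ) ∂μ) * K ^ (-δ) := integral_mul_const _ _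
    _ ≤ C * K ^ (-δ) := by gcongr

lemma abs_integral_sub_integral_clipReal_le [IsFiniteMeasure μ] {X : Ω → ℝ} {K δ C : ℝ}
    (hK : 0 < K) (hδ : 0 < δ) (hX : AEMeasurable X μ)
    (h : Integrable (fun ω => |X ω| ^ (1 + δ)) μ) (hC : ∫ ω, |X ω| ^ (1 + δ) ∂μ ≤ C) :
    |∫ ω, X ω ∂μ - ∫ ω, clipReal K (X ω) ∂μ| ≤ C * K ^ (-δ) := by
  rw [← integral_sub (integrable_of_integrable_abs_rpow hX (by linarith) h)
    (integrable_clipReal hK.le hX)]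
  exact abs_integral_le_integral_abs.trans (integral_abs_sub_clipReal_le hK hδ hX h hC)

end Moments

lemma exists_mul_rpow_neg_lt {C δ ε : ℝ} (hδ : 0 < δ) (hε : 0 < ε) :
    ∃ K : ℝ, 0 < K ∧ C * K ^ (-δ) < ε := by
  have h : Tendsto (fun K : ℝ => C * K ^ (-δ)) atTop (𝓝 (C * 0)) :=
    (tendsto_rpow_neg_atTop hδ).const_mul C
  rw [mul_zero] at h
  exact ((eventually_gt_atTop 0).and (h.eventually_lt_const hε)).exists

/-- Convergence in distribution and bounded moments of an order above one imply the convergence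
of the expectations. -/
lemma MeasureTheory.TendstoInDistribution.tendsto_integral {Ω Ω' : Type*} [MeasurableSpace Ω]
    [MeasurableSpace Ω'] {μ : ℕ → Measure Ω} [∀ n, IsProbabilityMeasure (μ n)] {ν : Measure Ω'}
    [IsProbabilityMeasure ν] {X : ℕ → Ω → ℝ} {Z : Ω' → ℝ}
    (hXZ : TendstoInDistribution X atTop Z μ ν) {δ C : ℝ} (hδ : 0 < δ)
    (hX : ∀ n, Integrable (fun ω => |X n ω| ^ (1 + δ)) (μ n))
    (hXC : ∀ n, ∫ ω, |X n ω| ^ (1 + δ) ∂(μ n) ≤ C)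
    (hZ : Integrable (fun ω => |Z ω| ^ (1 + δ)) ν) (hZC : ∫ ω, |Z ω| ^ (1 + δ) ∂ν ≤ C) :
    Tendsto (fun n => ∫ ω, X n ω ∂(μ n)) atTop (𝓝 (∫ ω, Z ω ∂ν)) := by
  rw [Metric.tendsto_atTop]
  intro ε hε
  -- Truncation costs less than `ε / 4` on each side; the bounded continuous truncated function gets
  -- the remaining `ε / 2`.
  obtain ⟨K, hK, hKε⟩ := exists_mul_rpow_neg_lt (C := C) hδ (show 0 < ε / 4 by positivity)
  let g : BoundedContinuousFunction ℝ ℝ :=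
    BoundedContinuousFunction.ofNormedAddCommGroup (clipReal K) (continuous_clipReal K) K
      (abs_clipReal_le hK.le)
  have h := ProbabilityMeasure.tendsto_iff_forall_integral_tendsto.1 hXZ.tendsto g
  have hg : Measurable (clipReal K) := (continuous_clipReal K).measurable
  have e1 : ∀ n, ∫ ω, g ω ∂((μ n).map (X n)) = ∫ ω, clipReal K (X n ω) ∂(μ n) := fun n =>
    integral_map (hXZ.forall_aemeasurable n) hg.aestronglyMeasurable
  have e2 : ∫ ω, g ω ∂(ν.map Z) = ∫ ω, clipReal K (Z ω) ∂ν :=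
    integral_map hXZ.aemeasurable_limit hg.aestronglyMeasurable
  simp only [ProbabilityMeasure.coe_mk, e1, e2] at h
  obtain ⟨N, hN⟩ := Metric.tendsto_atTop.1 h (ε / 2) (by positivity)
  refine ⟨N, fun n hn => ?_⟩
  have h1 := abs_integral_sub_integral_clipReal_le hK hδ (hXZ.forall_aemeasurable n) (hX n) (hXC n)
  have h2 := abs_integral_sub_integral_clipReal_le hK hδ hXZ.aemeasurable_limit hZ hZC
  have h3 := hN n hn
  rw [Real.dist_eq] at h3 ⊢
  rw [abs_lt] at h3 ⊢
  rw [abs_le] at h1 h2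
  constructor <;> linarith [h1.1, h1.2, h2.1, h2.2, h3.1, h3.2]

/-! ### Law of large numbers for triangular arrays -/

/-- The variance of the absolute deviation is nonnegative, so the squared mean of that deviation is
at most its second moment. -/
lemma integral_abs_sub_integral_le_sqrt_variance {Ω : Type*} [MeasurableSpace Ω] {μ : Measure Ω}
    [IsProbabilityMeasure μ] {Y : Ω → ℝ} (hY : MemLp Y 2 μ) :
    ∫ ω, |Y ω - ∫ ω', Y ω' ∂μ| ∂μ ≤ √(Var[Y; μ]) := by
  have hD : MemLp (fun ω => |Y ω - ∫ ω', Y ω' ∂μ|) 2 μ := (hY.sub (memLp_const _)).abs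
  refine Real.le_sqrt_of_sq_le ?_
  have h1 := variance_eq_sub hD
  have h2 := variance_nonneg (fun ω => |Y ω - ∫ ω', Y ω' ∂μ|) μ
  rw [variance_eq_integral hY.aestronglyMeasurable.aemeasurable]
  simp only [Pi.pow_apply, sq_abs] at h1
  linarith

/-- The average of the truncated variables has variance at most `K ^ 2 / n`, which gives the first
term. Truncation is paid for twice, in the average and in the mean. The level `K` stays free, to be
fixed before `n` grows. -/
lemma integral_abs_average_sub_le {Ω : Type*} [MeasurableSpace Ω] {μ : Measure Ω}
    [IsProbabilityMeasure μ] {X : ℕ → Ω → ℝ} (hindep : iIndepFun X μ)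
    (hident : ∀ t, IdentDistrib (X t) (X 0) μ μ) {δ C K : ℝ} (hδ : 0 < δ) (hK : 0 < K)
    (hX : Integrable (fun ω => |X 0 ω| ^ (1 + δ)) μ) (hXC : ∫ ω, |X 0 ω| ^ (1 + δ) ∂μ ≤ C)
    {n : ℕ} (hn : 1 ≤ n) :
    ∫ ω, |(n : ℝ)⁻¹ * ∑ t ∈ Finset.range n, X t ω - ∫ ω', X 0 ω' ∂μ| ∂μ
      ≤ K / √n + 2 * (C * K ^ (-δ)) := by
  have hn0 : (0 : ℝ) < n := by exact_mod_cast hn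
  have hm : ∀ t, AEMeasurable (X t) μ := fun t => (hident t).aemeasurable_fst
  have hclip : Measurable (clipReal K) := (continuous_clipReal K).measurable
  have hint0 : Integrable (X 0) μ := integrable_of_integrable_abs_rpow (hm 0) (by linarith) hX
  have hint : ∀ t, Integrable (X t) μ := fun t => (hident t).integrable_iff.2 hint0
  set T : ℕ → Ω → ℝ := fun t ω => clipReal K (X t ω) with hT
  have hTident : ∀ t, IdentDistrib (T t) (T 0) μ μ := fun t => (hident t).comp hclip
  have hTint : ∀ t, Integrable (T t) μ := fun t => integrable_clipReal hK.le (hm t)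
  have hTL : ∀ t, MemLp (T t) 2 μ := fun t =>
    MemLp.of_bound (hclip.comp_aemeasurable (hm t)).aestronglyMeasurable K
      (ae_of_all _ fun _ => abs_clipReal_le hK.le _)
  have htail : ∀ t, ∫ ω, |X t ω - T t ω| ∂μ ≤ C * K ^ (-δ) := fun t => by
    have : IdentDistrib (fun ω => |X t ω - T t ω|) (fun ω => |X 0 ω - T 0 ω|) μ μ :=
      (hident t).comp (u := fun x => |x - clipReal K x|) (by fun_prop)
    rw [this.integral_eq]
    exact integral_abs_sub_clipReal_le hK hδ (hm 0) hX hXC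
  set A : Ω → ℝ := fun ω => (n : ℝ)⁻¹ * ∑ t ∈ Finset.range n, T t ω with hA
  have hAL : MemLp A 2 μ := (memLp_finsetSum _ fun t _ => hTL t).const_mul _
  have hAmean : ∫ ω, A ω ∂μ = ∫ ω, T 0 ω ∂μ := by
    simp only [hA]
    rw [integral_const_mul, integral_finsetSum _ fun t _ => hTint t]
    simp only [fun t => (hTident t).integral_eq, Finset.sum_const, Finset.card_range, nsmul_eq_mul]
    field_simp
  have hAvar : Var[A; μ] ≤ K ^ 2 / n := by
    have h1 : Var[∑ t ∈ Finset.range n, T t; μ] = n * Var[T 0; μ] := by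
      rw [IndepFun.variance_sum (fun t _ => hTL t)]
      · simp only [fun t => (hTident t).variance_eq, Finset.sum_const, Finset.card_range,
          nsmul_eq_mul]
      · exact fun i _ j _ hij => (hindep.indepFun hij).comp hclip hclip
    have h2 : Var[T 0; μ] ≤ K ^ 2 := by
      have := variance_le_sq_of_bounded (a := -K) (b := K) (X := T 0) (μ := μ)
        (ae_of_all _ fun ω => abs_le.1 (abs_clipReal_le hK.le (X 0 ω)))
        (hclip.comp_aemeasurable (hm 0))
      calc _ ≤ _ := this
        _ = K ^ 2 := by ring
    have h3 : A = fun ω => (n : ℝ)⁻¹ * (∑ t ∈ Finset.range n, T t) ω := by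
      ext ω; simp [hA]
    rw [h3, variance_const_mul, h1]
    calc (n : ℝ)⁻¹ ^ 2 * (n * Var[T 0; μ]) = Var[T 0; μ] / n := by field_simp
      _ ≤ K ^ 2 / n := by gcongr
  have hAfin : ∫ ω, |A ω - ∫ ω', A ω' ∂μ| ∂μ ≤ K / √n := by
    refine (integral_abs_sub_integral_le_sqrt_variance hAL).trans ?_
    refine (Real.sqrt_le_sqrt hAvar).trans ?_
    rw [Real.sqrt_div' _ hn0.le, Real.sqrt_sq hK.le]
  have hmean := abs_integral_sub_integral_clipReal_le hK hδ (hm 0) hX hXC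
  have hAint : Integrable A μ := hAL.integrable (by norm_num)
  have hRint : ∀ t, Integrable (fun ω => |X t ω - T t ω|) μ := fun t => ((hint t).sub (hTint t)).abs
  have hsumint : Integrable (fun ω => (n : ℝ)⁻¹ * ∑ t ∈ Finset.range n, |X t ω - T t ω|) μ :=
    (integrable_finsetSum _ fun t _ => hRint t).const_mul _
  have hpt : ∀ ω, |(n : ℝ)⁻¹ * ∑ t ∈ Finset.range n, X t ω - ∫ ω', X 0 ω' ∂μ|
      ≤ |A ω - ∫ ω', A ω' ∂μ| + (n : ℝ)⁻¹ * ∑ t ∈ Finset.range n, |X t ω - T t ω|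
        + C * K ^ (-δ) := fun ω => by
    have h1 : (n : ℝ)⁻¹ * ∑ t ∈ Finset.range n, X t ω - ∫ ω', X 0 ω' ∂μ
        = (A ω - ∫ ω', A ω' ∂μ) + (n : ℝ)⁻¹ * ∑ t ∈ Finset.range n, (X t ω - T t ω)
          + -(∫ ω', X 0 ω' ∂μ - ∫ ω', T 0 ω' ∂μ) := by
      rw [hAmean, Finset.sum_sub_distrib]
      simp only [hA]
      ring
    rw [h1]
    refine (abs_add_three _ _ _).trans ?_
    rw [abs_neg, abs_mul, abs_of_nonneg (inv_nonneg.2 hn0.le)]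
    gcongr
    exact Finset.abs_sum_le_sum_abs _ _
  have hdev : Integrable (fun ω => |A ω - ∫ ω', A ω' ∂μ|) μ :=
    (hAint.sub (integrable_const _)).abs
  have hdevsum : Integrable (fun ω => |A ω - ∫ ω', A ω' ∂μ|
      + (n : ℝ)⁻¹ * ∑ t ∈ Finset.range n, |X t ω - T t ω|) μ := hdev.add hsumint
  have hsum : ∫ ω, (n : ℝ)⁻¹ * ∑ t ∈ Finset.range n, |X t ω - T t ω| ∂μ
      = (n : ℝ)⁻¹ * ∑ t ∈ Finset.range n, ∫ ω, |X t ω - T t ω| ∂μ := by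
    rw [integral_const_mul, integral_finsetSum _ fun t _ => hRint t]
  calc _ ≤ ∫ ω, (|A ω - ∫ ω', A ω' ∂μ| + (n : ℝ)⁻¹ * ∑ t ∈ Finset.range n, |X t ω - T t ω|
        + C * K ^ (-δ)) ∂μ := by
        refine integral_mono ?_ (hdevsum.add (integrable_const _)) hpt
        exact (((integrable_finsetSum _ fun t _ => hint t).const_mul _).sub
          (integrable_const _)).abs
    _ = ∫ ω, |A ω - ∫ ω', A ω' ∂μ| ∂μ
        + (n : ℝ)⁻¹ * ∑ t ∈ Finset.range n, ∫ ω, |X t ω - T t ω| ∂μ + C * K ^ (-δ) := by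
        rw [integral_add hdevsum (integrable_const _), integral_add hdev hsumint, hsum]
        simp
    _ ≤ K / √n + (n : ℝ)⁻¹ * ∑ t ∈ Finset.range n, C * K ^ (-δ) + C * K ^ (-δ) := by
        gcongr with t
        exact htail t
    _ = K / √n + 2 * (C * K ^ (-δ)) := by
        rw [Finset.sum_const, Finset.card_range, nsmul_eq_mul]
        field_simp
        ring

lemma tendsto_integral_abs_average_sub {Ω : Type*} [MeasurableSpace Ω] {μ : ℕ → Measure Ω}
    [∀ n, IsProbabilityMeasure (μ n)] {X : ℕ → ℕ → Ω → ℝ} (hindep : ∀ n, iIndepFun (X n) (μ n))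
    (hident : ∀ n t, IdentDistrib (X n t) (X n 0) (μ n) (μ n)) {δ C m : ℝ} (hδ : 0 < δ)
    (hX : ∀ n, Integrable (fun ω => |X n 0 ω| ^ (1 + δ)) (μ n))
    (hXC : ∀ n, ∫ ω, |X n 0 ω| ^ (1 + δ) ∂(μ n) ≤ C)
    (hm : Tendsto (fun n => ∫ ω, X n 0 ω ∂(μ n)) atTop (𝓝 m)) :
    Tendsto (fun n : ℕ => ∫ ω, |(n : ℝ)⁻¹ * ∑ t ∈ Finset.range n, X n t ω - m| ∂(μ n))
      atTop (𝓝 0) := by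
  rw [Metric.tendsto_atTop]
  intro ε hε
  -- Doubled, the tail term stays below `ε / 4`; `K / √n` and the drift of the mean take another `ε
  -- / 4` each.
  obtain ⟨K, hK, hKε⟩ := exists_mul_rpow_neg_lt (C := C) hδ (show 0 < ε / 8 by positivity)
  have hs : Tendsto (fun n : ℕ => K / √(n : ℝ)) atTop (𝓝 0) :=
    (Real.tendsto_sqrt_atTop.comp tendsto_natCast_atTop_atTop).const_div_atTop K
  have hev := (hs.eventually_lt_const (show 0 < ε / 4 by positivity)).and
    ((Metric.tendsto_nhds.1 hm (ε / 4) (by positivity)).and (eventually_ge_atTop 1))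
  obtain ⟨N, hN⟩ := eventually_atTop.1 hev
  refine ⟨N, fun n hn => ?_⟩
  obtain ⟨h1, h2, h3⟩ := hN n hn
  rw [Real.dist_eq] at h2
  have hint0 : ∀ t, Integrable (X n t) (μ n) := fun t => (hident n t).integrable_iff.2
    (integrable_of_integrable_abs_rpow (hident n 0).aemeasurable_fst (by linarith) (hX n))
  have hint : Integrable (fun ω => (n : ℝ)⁻¹ * ∑ t ∈ Finset.range n, X n t ω) (μ n) :=
    (integrable_finsetSum _ fun t _ => hint0 t).const_mul _
  have h4 := integral_abs_average_sub_le (hindep n) (hident n) hδ hK (hX n) (hXC n) h3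
  have h5 : ∫ ω, |(n : ℝ)⁻¹ * ∑ t ∈ Finset.range n, X n t ω - m| ∂(μ n)
      ≤ ∫ ω, (|(n : ℝ)⁻¹ * ∑ t ∈ Finset.range n, X n t ω - ∫ ω', X n 0 ω' ∂(μ n)|
        + |∫ ω', X n 0 ω' ∂(μ n) - m|) ∂(μ n) :=
    integral_mono (hint.sub (integrable_const _)).abs
      ((hint.sub (integrable_const _)).abs.add (integrable_const _)) fun ω => abs_sub_le _ _ _
  have hdev : Integrable (fun ω => |(n : ℝ)⁻¹ * ∑ t ∈ Finset.range n, X n t ω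
      - ∫ ω', X n 0 ω' ∂(μ n)|) (μ n) := (hint.sub (integrable_const _)).abs
  rw [integral_add hdev (integrable_const _)] at h5
  simp only [integral_const, probReal_univ, one_smul] at h5
  rw [Real.dist_eq, sub_zero, abs_of_nonneg (integral_nonneg fun ω => abs_nonneg _)]
  linarith

/-! ### Central limit theorem for triangular arrays -/

/-- For `|y| ≤ 1` the remainder is cubic, and `q ≤ 1` gives `|y| ^ 3 ≤ |y| ^ (2 + q)`. For `|y| > 1`
bounding each term separately suffices. Using an order below three avoids third moments. -/
lemma norm_exp_I_sub_taylor_le {q : ℝ} (hq0 : 0 ≤ q) (hq1 : q ≤ 1) (y : ℝ) :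
    ‖Complex.exp (y * Complex.I) - (1 + y * Complex.I - y ^ 2 / 2)‖ ≤ 4 * |y| ^ (2 + q) := by
  have hn : ‖(y : ℂ) * Complex.I‖ = |y| := by simp
  rcases le_or_gt |y| 1 with h | h
  · have h1 := Complex.exp_bound (x := y * Complex.I) (by rw [hn]; exact h) (n := 3) (by norm_num)
    have h2 : ∑ m ∈ Finset.range 3, ((y : ℂ) * Complex.I) ^ m / m.factorial
        = 1 + y * Complex.I - y ^ 2 / 2 := by
      simp [Finset.sum_range_succ, mul_pow, Nat.factorial]
      ring
    rw [h2, hn] at h1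
    refine h1.trans ?_
    have h3 : |y| ^ 3 ≤ |y| ^ (2 + q) := by
      rcases (abs_nonneg y).eq_or_lt with h0 | h0
      · rw [← h0, Real.zero_rpow (by linarith)]; norm_num
      · rw [← Real.rpow_natCast]
        exact Real.rpow_le_rpow_of_exponent_ge h0 h (by push_cast; linarith)
    have h4 : (Nat.succ 3 : ℝ) * ((Nat.factorial 3 : ℝ) * ((3 : ℕ) : ℝ))⁻¹ ≤ 4 := by
      norm_num [Nat.factorial]
    have h5 : 0 ≤ |y| ^ 3 := by positivity
    calc _ ≤ |y| ^ 3 * 4 := by gcongr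
      _ ≤ 4 * |y| ^ (2 + q) := by linarith
  · have h1 : ‖Complex.exp (y * Complex.I) - (1 + y * Complex.I - y ^ 2 / 2)‖
        ≤ 1 + (1 + |y| + |y| ^ 2 / 2) := by
      refine (norm_sub_le _ _).trans ?_
      rw [Complex.norm_exp_ofReal_mul_I]
      gcongr
      refine (norm_sub_le _ _).trans ?_
      gcongr
      · refine (norm_add_le _ _).trans ?_
        simp
      · simp
    have h2 : |y| ^ 2 ≤ |y| ^ (2 + q) := by
      rw [← Real.rpow_natCast]
      exact Real.rpow_le_rpow_of_exponent_le h.le (by push_cast; linarith)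
    nlinarith

/-- Integrate the pointwise Taylor bound at `s * Y ω`; the linear term drops out because `Y` is
centred. -/
lemma norm_integral_exp_sub_taylor_le {Ω : Type*} [MeasurableSpace Ω] {μ : Measure Ω}
    [IsProbabilityMeasure μ] {Y : Ω → ℝ} (hY : AEMeasurable Y μ) {q ν C : ℝ} (hq0 : 0 ≤ q)
    (hq1 : q ≤ 1) (hqν : q ≤ ν) (hYν : Integrable (fun ω => |Y ω| ^ (2 + ν)) μ)
    (hYC : ∫ ω, |Y ω| ^ (2 + ν) ∂μ ≤ C) (hmean : ∫ ω, Y ω ∂μ = 0) {s : ℝ} (hs : 0 ≤ s) :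
    ‖∫ ω, Complex.exp ((s * Y ω : ℝ) * Complex.I) ∂μ - (1 - s ^ 2 * (∫ ω, Y ω ^ 2 ∂μ : ℝ) / 2)‖
      ≤ 4 * (1 + C) * s ^ (2 + q) := by
  have hY1 : Integrable Y μ := integrable_of_integrable_abs_rpow hY (by linarith) hYν
  have hYq : Integrable (fun ω => |Y ω| ^ (2 + q)) μ :=
    integrable_abs_rpow_of_le hY (by linarith) (by linarith) hYν
  have hY2 : Integrable (fun ω => Y ω ^ 2) μ := by
    have := integrable_abs_rpow_of_le (p := 2) hY (by norm_num) (by linarith) hYν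
    refine this.congr (ae_of_all _ fun ω => ?_)
    simp
  have he : Integrable (fun ω => Complex.exp ((s * Y ω : ℝ) * Complex.I)) μ := by
    refine Integrable.of_bound ?_ 1 (ae_of_all _ fun ω => ?_)
    · have : AEMeasurable (fun ω => ((s * Y ω : ℝ) : ℂ) * Complex.I) μ := by fun_prop
      exact (Complex.measurable_exp.comp_aemeasurable this).aestronglyMeasurable
    · rw [Complex.norm_exp_ofReal_mul_I]
  have hlin : Integrable (fun ω => ((s * Y ω : ℝ) : ℂ) * Complex.I) μ :=
    (hY1.const_mul s).ofReal.mul_const _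
  have hsq : Integrable (fun ω => ((s * Y ω : ℝ) : ℂ) ^ 2 / 2) μ := by
    have : Integrable (fun ω => (((s ^ 2 * Y ω ^ 2 : ℝ)) : ℂ) / 2) μ :=
      (hY2.const_mul (s ^ 2)).ofReal.div_const _
    refine this.congr (ae_of_all _ fun ω => ?_)
    push_cast
    ring
  have hpoly : Integrable (fun ω => 1 + ((s * Y ω : ℝ) : ℂ) * Complex.I
      - ((s * Y ω : ℝ) : ℂ) ^ 2 / 2) μ := ((integrable_const _).add hlin).sub hsq
  have hval : ∫ ω, (1 + ((s * Y ω : ℝ) : ℂ) * Complex.I - ((s * Y ω : ℝ) : ℂ) ^ 2 / 2) ∂μ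
      = 1 - (s : ℂ) ^ 2 * ((∫ ω, Y ω ^ 2 ∂μ : ℝ) : ℂ) / 2 := by
    have hone : Integrable (fun ω => 1 + ((s * Y ω : ℝ) : ℂ) * Complex.I) μ :=
      (integrable_const _).add hlin
    rw [integral_sub hone hsq, integral_add (integrable_const _) hlin,
      integral_mul_const, integral_complex_ofReal, integral_const_mul, hmean]
    have : ∫ ω, ((s * Y ω : ℝ) : ℂ) ^ 2 / 2 ∂μ
        = ∫ ω, ((s ^ 2 / 2 * Y ω ^ 2 : ℝ) : ℂ) ∂μ := by
      refine integral_congr_ae (ae_of_all _ fun ω => ?_)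
      push_cast
      ring
    rw [this, integral_complex_ofReal, integral_const_mul]
    simp
    ring
  rw [← hval, ← integral_sub he hpoly]
  calc _ ≤ ∫ ω, 4 * (s ^ (2 + q) * |Y ω| ^ (2 + q)) ∂μ := by
        refine norm_integral_le_of_norm_le ((hYq.const_mul _).const_mul _) (ae_of_all _ fun ω => ?_)
        refine (norm_exp_I_sub_taylor_le hq0 hq1 (s * Y ω)).trans_eq ?_
        rw [abs_mul, abs_of_nonneg hs, Real.mul_rpow hs (abs_nonneg _)]
    _ = 4 * (s ^ (2 + q) * ∫ ω, |Y ω| ^ (2 + q) ∂μ) := by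
        rw [integral_const_mul, integral_const_mul]
    _ ≤ 4 * (s ^ (2 + q) * ∫ ω, (1 + |Y ω| ^ (2 + ν)) ∂μ) := by
        gcongr 4 * (s ^ (2 + q) * ?_)
        exact integral_mono hYq ((integrable_const _).add hYν) fun ω =>
          rpow_le_one_add_rpow (abs_nonneg _) (by linarith) (by linarith)
    _ ≤ 4 * (s ^ (2 + q) * (1 + C)) := by
        gcongr 4 * (s ^ (2 + q) * ?_)
        rw [integral_add (integrable_const _) hYν]
        simpa using hYC
    _ = _ := by ring

/-- Lyapunov's central limit theorem for characteristic functions: in row `n` of the array there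
are `n` independent copies of the centred variable `Y n`, scaled by `1 / √n`. -/
lemma tendsto_integral_exp_pow {Ω : Type*} [MeasurableSpace Ω] {μ : ℕ → Measure Ω}
    [∀ n, IsProbabilityMeasure (μ n)] {Y : ℕ → Ω → ℝ} (hY : ∀ n, AEMeasurable (Y n) (μ n))
    {ν C v : ℝ} (hν : 0 < ν) (hYν : ∀ n, Integrable (fun ω => |Y n ω| ^ (2 + ν)) (μ n))
    (hYC : ∀ n, ∫ ω, |Y n ω| ^ (2 + ν) ∂(μ n) ≤ C) (hmean : ∀ n, ∫ ω, Y n ω ∂(μ n) = 0)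
    (hv : Tendsto (fun n => ∫ ω, Y n ω ^ 2 ∂(μ n)) atTop (𝓝 v)) :
    Tendsto (fun n : ℕ => (∫ ω, Complex.exp (((√(n : ℝ))⁻¹ * Y n ω : ℝ) * Complex.I) ∂(μ n)) ^ n)
      atTop (𝓝 (Complex.exp (-v / 2))) := by
  set φ : ℕ → ℂ := fun n => ∫ ω, Complex.exp (((√(n : ℝ))⁻¹ * Y n ω : ℝ) * Complex.I) ∂(μ n)
  -- The Taylor bound gains at most one order beyond the second, however large `ν` is.
  set q : ℝ := min ν 1
  have hq0 : 0 < q := lt_min hν one_pos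
  have hb : ∀ n, ‖φ n - (1 - ((√(n : ℝ))⁻¹ : ℝ) ^ 2 * (∫ ω, Y n ω ^ 2 ∂(μ n) : ℝ) / 2)‖
      ≤ 4 * (1 + C) * (√(n : ℝ))⁻¹ ^ (2 + q) := fun n =>
    norm_integral_exp_sub_taylor_le (hY n) hq0.le (min_le_right _ _) (min_le_left _ _) (hYν n)
      (hYC n) (hmean n) (by positivity)
  -- It suffices to find the limit of `n * (φ n - 1)`, as `(1 + z n / n) ^ n` tends to `exp z` when
  -- `z n` tends to `z`. The Taylor remainder, multiplied by `n`, is of order `(√n) ^ (-q)`.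
  have hlim : Tendsto (fun n : ℕ => (n : ℂ) * (φ n - 1)) atTop (𝓝 (-v / 2)) := by
    have h1 : Tendsto (fun n : ℕ => (-(∫ ω, Y n ω ^ 2 ∂(μ n) : ℝ) / 2 : ℂ)) atTop
        (𝓝 (-v / 2)) :=
      (((Complex.continuous_ofReal.tendsto v).comp hv).neg).div_const 2
    have h2 : Tendsto (fun n : ℕ => 4 * (1 + C) * (√(n : ℝ)) ^ (-q)) atTop (𝓝 0) := by
      have := ((tendsto_rpow_neg_atTop hq0).comp
        (Real.tendsto_sqrt_atTop.comp tendsto_natCast_atTop_atTop)).const_mul (4 * (1 + C))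
      rw [mul_zero] at this
      exact this
    have h3 : Tendsto (fun n : ℕ => (n : ℂ) * (φ n - 1)
        - (-(∫ ω, Y n ω ^ 2 ∂(μ n) : ℝ) / 2 : ℂ)) atTop (𝓝 0) := by
      refine squeeze_zero_norm' ?_ h2
      filter_upwards [eventually_ge_atTop 1] with n hn
      have hn0 : (0 : ℝ) < n := by exact_mod_cast hn
      have hs : 0 < √(n : ℝ) := Real.sqrt_pos.2 hn0
      have hsq : (√(n : ℝ)) ^ 2 = n := Real.sq_sqrt hn0.le
      have e1 : (n : ℂ) * (φ n - 1) - (-(∫ ω, Y n ω ^ 2 ∂(μ n) : ℝ) / 2 : ℂ)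
          = n * (φ n - (1 - ((√(n : ℝ))⁻¹ : ℝ) ^ 2 * (∫ ω, Y n ω ^ 2 ∂(μ n) : ℝ) / 2)) := by
        have hc : (((√(n : ℝ))⁻¹ : ℝ) : ℂ) ^ 2 = (n : ℂ)⁻¹ := by
          rw [← Complex.ofReal_pow, inv_pow, hsq]
          push_cast
          rfl
        have hnc : (n : ℂ) ≠ 0 := by exact_mod_cast hn0.ne'
        rw [hc]
        field_simp
        ring
      rw [e1, norm_mul, Complex.norm_natCast]
      calc (n : ℝ) * _ ≤ n * (4 * (1 + C) * (√(n : ℝ))⁻¹ ^ (2 + q)) := by gcongr; exact hb n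
        _ = 4 * (1 + C) * (√(n : ℝ)) ^ (-q) := by
          rw [Real.inv_rpow hs.le, Real.rpow_add hs, Real.rpow_neg hs.le]
          have : (√(n : ℝ)) ^ (2 : ℝ) = n := by rw [Real.rpow_two, hsq]
          rw [this]
          field_simp
    have := h3.add h1
    simpa using this
  refine (Complex.tendsto_one_add_pow_exp_of_tendsto hlim).congr fun n => ?_
  rw [add_sub_cancel]

/-! ### Convergence in probability to zero and continuous mapping with a parameter -/

lemma tendstoZeroInProbability_of_tendsto_integral {Ω : Type*} [MeasurableSpace Ω]
    {μ : ℕ → Measure Ω} {Y : ℕ → Ω → ℝ} (hY : ∀ n, Integrable (Y n) (μ n)) (hY0 : ∀ n ω, 0 ≤ Y n ω)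
    (h : Tendsto (fun n => ∫ ω, Y n ω ∂(μ n)) atTop (𝓝 0)) :
    TendstoZeroInProbability μ fun n ω => ENNReal.ofReal (Y n ω) := by
  intro δ hδ
  -- Markov's inequality needs a finite threshold, whereas `δ` may be `∞`.
  set δ' : ℝ≥0∞ := min δ 1
  have hδ0 : δ' ≠ 0 := (lt_min hδ one_pos).ne'
  have hδt : δ' ≠ ∞ := ((min_le_right _ _).trans_lt ENNReal.one_lt_top).ne
  have hlim : Tendsto (fun n => ENNReal.ofReal (∫ ω, Y n ω ∂(μ n)) / δ') atTop (𝓝 0) := by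
    have := ENNReal.Tendsto.div_const (ENNReal.tendsto_ofReal h) (b := δ') (Or.inr hδ0)
    simpa using this
  refine tendsto_of_tendsto_of_tendsto_of_le_of_le tendsto_const_nhds hlim
    (fun _ => zero_le) fun n => ?_
  simp only
  rw [ofReal_integral_eq_lintegral_ofReal (hY n) (ae_of_all _ (hY0 n))]
  refine (measure_mono fun ω (hω : δ ≤ _) => ?_).trans
    (meas_ge_le_lintegral_div (hY n).1.aemeasurable.ennreal_ofReal hδ0 hδt)
  exact (min_le_left _ _).trans hω

lemma TendstoZeroInProbability.of_le {Ω : Type*} [MeasurableSpace Ω] {μ : ℕ → Measure Ω}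
    {X Y : ℕ → Ω → ℝ≥0∞} (hY : TendstoZeroInProbability μ Y) (h : ∀ n ω, X n ω ≤ Y n ω) :
    TendstoZeroInProbability μ X := fun δ hδ =>
  tendsto_of_tendsto_of_tendsto_of_le_of_le tendsto_const_nhds (hY δ hδ) (fun _ => zero_le)
    fun n => measure_mono fun ω (hω : δ ≤ X n ω) => hω.trans (h n ω)

/-- A sequence that is dominated by an `o_p(1)` sequence on events of probability approaching one
is itself `o_p(1)`. -/
lemma TendstoZeroInProbability.of_le_of_lt {Ω : Type*} [MeasurableSpace Ω] {μ : ℕ → Measure Ω}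
    {X Y B : ℕ → Ω → ℝ≥0∞} {a : ℝ≥0∞} (hY : TendstoZeroInProbability μ Y)
    (hB : TendstoZeroInProbability μ B) (ha : 0 < a)
    (h : ∀ᶠ n in atTop, ∀ ω, B n ω < a → X n ω ≤ Y n ω) :
    TendstoZeroInProbability μ X := fun δ hδ => by
  have hsum := (hY δ hδ).add (hB a ha)
  rw [add_zero] at hsum
  refine tendsto_of_tendsto_of_tendsto_of_le_of_le' tendsto_const_nhds hsum
    (Eventually.of_forall fun _ => zero_le) ?_
  filter_upwards [h] with n hn
  refine (measure_mono fun ω (hω : δ ≤ X n ω) => ?_).trans (measure_union_le _ _)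
  rcases lt_or_ge (B n ω) a with h1 | h1
  · exact Or.inl (hω.trans (hn ω h1))
  · exact Or.inr h1

lemma map_prod_dirac_eq_map {Ω E F : Type*} [MeasurableSpace Ω] [MeasurableSpace E]
    [MeasurableSpace F] {ρ : Measure Ω} [IsProbabilityMeasure ρ] {V : Ω → E}
    (hV : AEMeasurable V ρ) (c : F) :
    (ρ.map V).prod (Measure.dirac c) = ρ.map fun ω => (V ω, c) := by
  have := Measure.isProbabilityMeasure_map hV
  rw [Measure.prod_dirac, AEMeasurable.map_map_of_aemeasurable (by fun_prop) hV]
  rfl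

/-- Continuous mapping theorem for a function with a convergent deterministic parameter. -/
lemma MeasureTheory.TendstoInDistribution.continuous_comp_param {Ω Ω' E F G : Type*}
    [MeasurableSpace Ω] [MeasurableSpace Ω'] {μ : ℕ → Measure Ω} [∀ n, IsProbabilityMeasure (μ n)]
    {ν : Measure Ω'} [IsProbabilityMeasure ν]
    [MetricSpace E] [SecondCountableTopology E] [MeasurableSpace E] [BorelSpace E]
    [MetricSpace F] [SecondCountableTopology F] [MeasurableSpace F] [BorelSpace F]
    [TopologicalSpace G] [MeasurableSpace G] [BorelSpace G]
    {X : ℕ → Ω → E} {Z : Ω' → E} (h : TendstoInDistribution X atTop Z μ ν)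
    {θ : ℕ → F} {θ₀ : F} (hθ : Tendsto θ atTop (𝓝 θ₀)) {g : E × F → G} (hg : Continuous g) :
    TendstoInDistribution (fun n ω => g (X n ω, θ n)) atTop (fun ω => g (Z ω, θ₀)) μ ν := by
  have hpair : TendstoInDistribution (fun n ω => (X n ω, θ n)) atTop (fun ω => (Z ω, θ₀)) μ ν := by
    refine ⟨fun n => (h.forall_aemeasurable n).prodMk aemeasurable_const,
      h.aemeasurable_limit.prodMk aemeasurable_const, ?_⟩
    -- A constant is independent of everything, so the joint law is a product with a Dirac mass;
    -- products of probability measures are weakly continuous in both factors.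
    have hlim := (ProbabilityMeasure.continuous_prod.tendsto _).comp
      (h.tendsto.prodMk_nhds ((continuous_diracProba.tendsto θ₀).comp hθ))
    have hν := Measure.isProbabilityMeasure_map (h.aemeasurable_limit.prodMk
      (aemeasurable_const (b := θ₀)))
    have e : ProbabilityMeasure.prod ⟨ν.map Z, Measure.isProbabilityMeasure_map
        h.aemeasurable_limit⟩ (diracProba θ₀) = ⟨ν.map fun ω => (Z ω, θ₀), hν⟩ :=
      Subtype.ext (map_prod_dirac_eq_map h.aemeasurable_limit θ₀)
    rw [e] at hlim
    exact hlim.congr fun n => Subtype.ext (map_prod_dirac_eq_map (h.forall_aemeasurable n) (θ n))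
  exact hpair.continuous_comp hg

/-! ### The least-squares objective function -/

/-- The quadratic form attains a positive minimum on the compact unit sphere, and homogeneity
extends the bound. The sphere is empty when `k = 0`. -/
lemma Matrix.PosDef.exists_pos_mul_norm_sq_le {k : ℕ} {A : Matrix (Fin k) (Fin k) ℝ}
    (hA : A.PosDef) : ∃ c : ℝ, 0 < c ∧ ∀ u : EuclideanSpace ℝ (Fin k),
      c * ‖u‖ ^ 2 ≤ ∑ i, ∑ j, u i * A i j * u j := by
  have hq : Continuous fun u : EuclideanSpace ℝ (Fin k) => ∑ i, ∑ j, u i * A i j * u j := by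
    fun_prop
  have hpos : ∀ u : EuclideanSpace ℝ (Fin k), u ≠ 0 → 0 < ∑ i, ∑ j, u i * A i j * u j := by
    intro u hu
    have h := hA.dotProduct_mulVec_pos (x := u.ofLp) (by simpa using hu)
    simpa [dotProduct, Matrix.mulVec, Finset.mul_sum, mul_assoc] using h
  rcases (Metric.sphere (0 : EuclideanSpace ℝ (Fin k)) 1).eq_empty_or_nonempty with he | hne
  · refine ⟨1, one_pos, fun u => ?_⟩
    have hu : u = 0 := by
      by_contra hu
      have : ‖u‖⁻¹ • u ∈ Metric.sphere (0 : EuclideanSpace ℝ (Fin k)) 1 := by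
        simp [norm_smul, hu]
      rw [he] at this
      exact this
    simp [hu]
  · obtain ⟨v, hv, hmin⟩ := (isCompact_sphere _ _).exists_isMinOn hne hq.continuousOn
    have hv0 : v ≠ 0 := by
      rintro rfl
      simp at hv
    refine ⟨_, hpos v hv0, fun u => ?_⟩
    rcases eq_or_ne u 0 with rfl | hu
    · simp
    · have hu' : ‖u‖ ≠ 0 := norm_ne_zero_iff.2 hu
      have h1 := hmin (show ‖u‖⁻¹ • u ∈ Metric.sphere (0 : EuclideanSpace ℝ (Fin k)) 1 by
        simp [norm_smul, hu])
      have h2 : ∑ i, ∑ j, (‖u‖⁻¹ • u) i * A i j * (‖u‖⁻¹ • u) j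
          = (‖u‖ ^ 2)⁻¹ * ∑ i, ∑ j, u i * A i j * u j := by
        simp only [Finset.mul_sum, PiLp.smul_apply, smul_eq_mul]
        refine Finset.sum_congr rfl fun i _ => Finset.sum_congr rfl fun j _ => ?_
        field_simp
      simp only [Set.mem_ofPred_eq] at h1
      rw [h2, ← div_eq_inv_mul, le_div_iff₀ (by positivity)] at h1
      exact h1

lemma abs_sum_mul_mul_le {k : ℕ} (A : Matrix (Fin k) (Fin k) ℝ) (u : EuclideanSpace ℝ (Fin k)) :
    |∑ i, ∑ j, u i * A i j * u j| ≤ (∑ i, ∑ j, |A i j|) * ‖u‖ ^ 2 := by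
  rw [Finset.sum_mul]
  refine (Finset.abs_sum_le_sum_abs _ _).trans (Finset.sum_le_sum fun i _ => ?_)
  rw [Finset.sum_mul]
  refine (Finset.abs_sum_le_sum_abs _ _).trans (Finset.sum_le_sum fun j _ => ?_)
  rw [abs_mul, abs_mul]
  have hi : |u i| ≤ ‖u‖ := PiLp.norm_apply_le u i
  have hj : |u j| ≤ ‖u‖ := PiLp.norm_apply_le u j
  calc |u i| * |A i j| * |u j| ≤ ‖u‖ * |A i j| * ‖u‖ := by gcongr
    _ = |A i j| * ‖u‖ ^ 2 := by ring

lemma isClosed_paramSpace (d : ℕ) : IsClosed (paramSpace d) := by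
  simp only [paramSpace, Set.ofPred_forall]
  exact isClosed_iInter fun i => isClosed_le continuous_const (by fun_prop)

lemma isClosed_nullParamSpace (d : ℕ) : IsClosed (nullParamSpace d) :=
  (isClosed_paramSpace d).inter (isClosed_eq (by fun_prop) continuous_const)

lemma add_smul_single_mem_paramSpace {d : ℕ} {θ : EuclideanSpace ℝ (Fin (d + 1))}
    (hθ : θ ∈ paramSpace d) (i : Fin (d + 1)) {s : ℝ} (hs : 0 ≤ s) :
    θ + s • EuclideanSpace.single i 1 ∈ paramSpace d := fun j => by
  have h1 := hθ j
  have h2 : 0 ≤ (EuclideanSpace.single i (1 : ℝ) : EuclideanSpace ℝ (Fin (d + 1))) j := by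
    simp only [PiLp.single_apply]
    split_ifs <;> norm_num
  simp only [PiLp.add_apply, PiLp.smul_apply, smul_eq_mul]
  positivity

/-- From any point of the orthant all nonnegative steps along a coordinate axis are allowed, so the
derivative within the admissible steps is unique, also on the boundary. -/
lemma lrPartial_paramSpace_eq {d : ℕ} {f : EuclideanSpace ℝ (Fin (d + 1)) → ℝ} {f' : ℝ}
    {θ : EuclideanSpace ℝ (Fin (d + 1))} (hθ : θ ∈ paramSpace d) {i : Fin (d + 1)}
    (h : HasLineDerivWithinAt ℝ f f' (paramSpace d) θ (EuclideanSpace.single i 1)) :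
    lrPartial (paramSpace d) i f θ = f' := by
  refine HasDerivWithinAt.derivWithin h ?_
  exact (uniqueDiffWithinAt_Ici (0 : ℝ)).mono fun s hs => add_smul_single_mem_paramSpace hθ i hs

namespace RegressionModel

variable {d : ℕ} {Φ Ω : Type*} [MeasurableSpace Ω] (M : RegressionModel d Φ Ω)

/-- The `i`-th coordinate of the score of the least-squares objective function. -/
noncomputable def score (n : ℕ) (ω : Ω) (θ : EuclideanSpace ℝ (Fin (d + 1))) (i : Fin (d + 1)) :
    ℝ :=
  ∑ t ∈ Finset.range n, M.x t ω i * M.err θ t ω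

/-- The Gram matrix `∑_t x_t x_t'`. -/
noncomputable def gram (n : ℕ) (ω : Ω) : Matrix (Fin (d + 1)) (Fin (d + 1)) ℝ :=
  Matrix.of fun i j => ∑ t ∈ Finset.range n, M.x t ω i * M.x t ω j

variable {M}

lemma objective_eq_err (n : ℕ) (ω : Ω) (θ : EuclideanSpace ℝ (Fin (d + 1))) :
    M.objective n ω θ = -(1 / 2) * ∑ t ∈ Finset.range n, M.err θ t ω ^ 2 := by
  simp only [objective, err, mul_comm]

lemma err_add (θ u : EuclideanSpace ℝ (Fin (d + 1))) (t : ℕ) (ω : Ω) :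
    M.err (θ + u) t ω = M.err θ t ω - ∑ i, u i * M.x t ω i := by
  simp only [err, PiLp.add_apply, add_mul, Finset.sum_add_distrib]
  ring

/-- Expand the square of the shifted error. There is no remainder, so derivatives and maximizers can
both be read off. -/
lemma objective_add (n : ℕ) (ω : Ω) (θ u : EuclideanSpace ℝ (Fin (d + 1))) :
    M.objective n ω (θ + u) = M.objective n ω θ + ∑ i, u i * M.score n ω θ i
      - 1 / 2 * ∑ i, ∑ j, u i * M.gram n ω i j * u j := by
  have h1 : ∑ i, u i * M.score n ω θ i
      = ∑ t ∈ Finset.range n, M.err θ t ω * ∑ i, u i * M.x t ω i := by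
    simp only [score, Finset.mul_sum]
    rw [Finset.sum_comm]
    exact Finset.sum_congr rfl fun t _ => Finset.sum_congr rfl fun i _ => by ring
  have h2 : ∑ i, ∑ j, u i * M.gram n ω i j * u j
      = ∑ t ∈ Finset.range n, (∑ i, u i * M.x t ω i) ^ 2 := by
    simp only [sq, Finset.sum_mul_sum]
    rw [Finset.sum_comm (s := Finset.range n)]
    refine Finset.sum_congr rfl fun i _ => ?_
    rw [Finset.sum_comm (s := Finset.range n)]
    refine Finset.sum_congr rfl fun j _ => ?_
    simp only [gram, Matrix.of_apply, Finset.mul_sum, Finset.sum_mul]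
    exact Finset.sum_congr rfl fun t _ => by ring
  rw [h1, h2]
  simp only [objective_eq_err, err_add, Finset.mul_sum, ← Finset.sum_add_distrib,
    ← Finset.sum_sub_distrib]
  refine Finset.sum_congr rfl fun t _ => ?_
  rw [← Finset.mul_sum]
  ring

lemma score_add (n : ℕ) (ω : Ω) (θ u : EuclideanSpace ℝ (Fin (d + 1))) (i : Fin (d + 1)) :
    M.score n ω (θ + u) i = M.score n ω θ i - ∑ j, u j * M.gram n ω i j := by
  simp only [score, gram, Matrix.of_apply, err_add, Finset.mul_sum, mul_sub,
    Finset.sum_sub_distrib]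
  rw [Finset.sum_comm (s := Finset.univ)]
  congr 1
  exact Finset.sum_congr rfl fun t _ => Finset.sum_congr rfl fun j _ => by ring

lemma continuous_objective (n : ℕ) (ω : Ω) : Continuous (M.objective n ω) := by
  unfold objective
  fun_prop

lemma continuous_score (n : ℕ) (ω : Ω) (i : Fin (d + 1)) :
    Continuous fun θ => M.score n ω θ i := by
  unfold score err
  fun_prop

lemma hasLineDerivWithinAt_objective (n : ℕ) (ω : Ω) (i : Fin (d + 1))
    (θ : EuclideanSpace ℝ (Fin (d + 1))) :
    HasLineDerivWithinAt ℝ (M.objective n ω) (M.score n ω θ i) (paramSpace d) θ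
      (EuclideanSpace.single i 1) := by
  refine HasLineDerivAt.hasLineDerivWithinAt ?_ _
  have h : (fun s : ℝ => M.objective n ω (θ + s • EuclideanSpace.single i 1))
      = fun s => M.objective n ω θ + s * M.score n ω θ i - 1 / 2 * (s * M.gram n ω i i * s) := by
    ext s
    rw [objective_add]
    simp [PiLp.single_apply]
  unfold HasLineDerivAt
  rw [h]
  have h1 := ((hasDerivAt_id (0 : ℝ)).mul_const (M.score n ω θ i)).const_add (M.objective n ω θ)
  have h2 := (((hasDerivAt_id (0 : ℝ)).mul_const (M.gram n ω i i)).mul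
    (hasDerivAt_id (0 : ℝ))).const_mul (1 / 2)
  convert! h1.sub h2 using 1
  simp

lemma hasLineDerivWithinAt_score (n : ℕ) (ω : Ω) (i j : Fin (d + 1))
    (θ : EuclideanSpace ℝ (Fin (d + 1))) :
    HasLineDerivWithinAt ℝ (fun θ => M.score n ω θ i) (-M.gram n ω i j) (paramSpace d) θ
      (EuclideanSpace.single j 1) := by
  refine HasLineDerivAt.hasLineDerivWithinAt ?_ _
  have h : (fun s : ℝ => M.score n ω (θ + s • EuclideanSpace.single j 1) i)
      = fun s => M.score n ω θ i - s * M.gram n ω i j := by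
    ext s
    rw [score_add]
    simp [PiLp.single_apply]
  unfold HasLineDerivAt
  rw [h]
  have h1 := ((hasDerivAt_id (0 : ℝ)).mul_const (M.gram n ω i j)).const_sub (M.score n ω θ i)
  convert! h1 using 1
  simp

lemma lrPartial_objective (n : ℕ) (ω : Ω) (i : Fin (d + 1)) {θ : EuclideanSpace ℝ (Fin (d + 1))}
    (hθ : θ ∈ paramSpace d) :
    lrPartial (paramSpace d) i (M.objective n ω) θ = M.score n ω θ i :=
  lrPartial_paramSpace_eq hθ (hasLineDerivWithinAt_objective n ω i θ)

/-- The first partial derivative is identified with the score only on `paramSpace d`; the derivative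
within that set sees nothing else. -/
lemma hasLineDerivWithinAt_lrPartial_objective (n : ℕ) (ω : Ω) (i j : Fin (d + 1))
    {θ : EuclideanSpace ℝ (Fin (d + 1))} (hθ : θ ∈ paramSpace d) :
    HasLineDerivWithinAt ℝ (lrPartial (paramSpace d) i (M.objective n ω)) (-M.gram n ω i j)
      (paramSpace d) θ (EuclideanSpace.single j 1) :=
  (hasLineDerivWithinAt_score n ω i j θ).congr (fun _ h => lrPartial_objective n ω i h)
    (lrPartial_objective n ω i hθ)

lemma lrPartial_lrPartial_objective (n : ℕ) (ω : Ω) (i j : Fin (d + 1))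
    {θ : EuclideanSpace ℝ (Fin (d + 1))} (hθ : θ ∈ paramSpace d) :
    lrPartial (paramSpace d) j (lrPartial (paramSpace d) i (M.objective n ω)) θ
      = -M.gram n ω i j :=
  lrPartial_paramSpace_eq hθ (hasLineDerivWithinAt_lrPartial_objective n ω i j hθ)

lemma lrHessian_objective (n : ℕ) (ω : Ω) {θ : EuclideanSpace ℝ (Fin (d + 1))}
    (hθ : θ ∈ paramSpace d) : lrHessian (paramSpace d) (M.objective n ω) θ = -M.gram n ω := by
  ext i j
  exact lrPartial_lrPartial_objective n ω i j hθ

lemma hasContinuousLRPartialsTwo_objective (n : ℕ) (ω : Ω) :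
    HasContinuousLRPartialsTwo (paramSpace d) (M.objective n ω) := by
  refine ⟨fun i => ⟨fun θ _ => ?_, ?_⟩, fun i j => ⟨fun θ hθ => ?_, ?_⟩⟩
  · exact (hasLineDerivWithinAt_objective n ω i θ).lineDifferentiableWithinAt
  · exact (continuous_score n ω i).continuousOn.congr fun θ hθ => lrPartial_objective n ω i hθ
  · exact (hasLineDerivWithinAt_lrPartial_objective n ω i j hθ).lineDifferentiableWithinAt
  · exact continuousOn_const.congr fun θ hθ => lrPartial_lrPartial_objective n ω i j hθ

/-- If the normalized Gram matrix is close to a positive definite matrix, then the increments of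
the objective function are bounded by a negative definite quadratic function. -/
lemma objective_add_le {A : Matrix (Fin (d + 1)) (Fin (d + 1)) ℝ} {c : ℝ}
    (hA : ∀ u : EuclideanSpace ℝ (Fin (d + 1)), c * ‖u‖ ^ 2 ≤ ∑ i, ∑ j, u i * A i j * u j)
    {n : ℕ} (hn : 1 ≤ n) {ω : Ω}
    (hB : ∑ i, ∑ j, |(n : ℝ)⁻¹ * M.gram n ω i j - A i j| ≤ c / 2)
    (θ u : EuclideanSpace ℝ (Fin (d + 1))) :
    M.objective n ω (θ + u) ≤ M.objective n ω θ
      + n * (‖u‖ * (∑ i, |(n : ℝ)⁻¹ * M.score n ω θ i| - c / 4 * ‖u‖)) := by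
  have hn0 : (0 : ℝ) < n := by exact_mod_cast hn
  have h1 : ∑ i, u i * M.score n ω θ i ≤ n * (‖u‖ * ∑ i, |(n : ℝ)⁻¹ * M.score n ω θ i|) := by
    rw [Finset.mul_sum, Finset.mul_sum]
    refine Finset.sum_le_sum fun i _ => ?_
    have hi : |u i| ≤ ‖u‖ := PiLp.norm_apply_le u i
    calc u i * M.score n ω θ i ≤ |u i| * |M.score n ω θ i| := by
          rw [← abs_mul]; exact le_abs_self _
      _ ≤ ‖u‖ * |M.score n ω θ i| := by gcongr
      _ = n * (‖u‖ * |(n : ℝ)⁻¹ * M.score n ω θ i|) := by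
          rw [abs_mul, abs_of_pos (inv_pos.2 hn0)]
          field_simp
  have h2 := abs_sum_mul_mul_le (Matrix.of fun i j => (n : ℝ)⁻¹ * M.gram n ω i j - A i j) u
  have h3 : ∑ i, ∑ j, u i * (Matrix.of fun i j => (n : ℝ)⁻¹ * M.gram n ω i j - A i j) i j * u j
      = (n : ℝ)⁻¹ * (∑ i, ∑ j, u i * M.gram n ω i j * u j) - ∑ i, ∑ j, u i * A i j * u j := by
    simp only [Matrix.of_apply, Finset.mul_sum, ← Finset.sum_sub_distrib]
    exact Finset.sum_congr rfl fun i _ => Finset.sum_congr rfl fun j _ => by ring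
  rw [h3] at h2
  simp only [Matrix.of_apply] at h2
  have h4 : (∑ i, ∑ j, |(n : ℝ)⁻¹ * M.gram n ω i j - A i j|) * ‖u‖ ^ 2 ≤ c / 2 * ‖u‖ ^ 2 := by
    gcongr
  have h5 := (abs_le.1 (h2.trans h4)).1
  -- The form of the normalized Gram matrix keeps at least `c - c / 2`; the factor `1 / 2` in the
  -- expansion then produces `c / 4`.
  have h6 : c / 2 * ‖u‖ ^ 2 ≤ (n : ℝ)⁻¹ * ∑ i, ∑ j, u i * M.gram n ω i j * u j := by
    linarith [hA u]
  rw [inv_mul_eq_div, le_div_iff₀ hn0] at h6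
  rw [objective_add]
  linarith

/-- Outside the ball of radius `4 * G / c` about a point of `S` the objective does not exceed its
value at that point, so continuity and closedness suffice although `S` may be unbounded. -/
lemma exists_mem_argmaxSet_objective {A : Matrix (Fin (d + 1)) (Fin (d + 1)) ℝ} {c : ℝ}
    (hc : 0 < c)
    (hA : ∀ u : EuclideanSpace ℝ (Fin (d + 1)), c * ‖u‖ ^ 2 ≤ ∑ i, ∑ j, u i * A i j * u j)
    {n : ℕ} (hn : 1 ≤ n) {ω : Ω}
    (hB : ∑ i, ∑ j, |(n : ℝ)⁻¹ * M.gram n ω i j - A i j| ≤ c / 2)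
    {S : Set (EuclideanSpace ℝ (Fin (d + 1)))} (hS : IsClosed S) (hne : S.Nonempty) :
    (argmaxSet (M.objective n ω) S).Nonempty := by
  obtain ⟨θ, hθ⟩ := hne
  have hn0 : (0 : ℝ) < n := by exact_mod_cast hn
  set G := ∑ i, |(n : ℝ)⁻¹ * M.score n ω θ i|
  obtain ⟨T, hT, hmax⟩ := (continuous_objective n ω).continuousOn.exists_isMaxOn' hS hθ (by
    refine Filter.Eventually.filter_mono inf_le_left ?_
    filter_upwards [(isCompact_closedBall θ (4 * G / c)).compl_mem_cocompact] with ϑ hϑ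
    have hr : 4 * G / c < ‖ϑ - θ‖ := by simpa [dist_eq_norm] using hϑ
    have h := objective_add_le hA hn hB θ (ϑ - θ)
    rw [add_sub_cancel] at h
    rw [div_lt_iff₀ hc] at hr
    have h2 : ‖ϑ - θ‖ * (G - c / 4 * ‖ϑ - θ‖) ≤ 0 :=
      mul_nonpos_of_nonneg_of_nonpos (norm_nonneg _) (by linarith)
    have h3 := mul_nonpos_of_nonneg_of_nonpos hn0.le h2
    linarith)
  exact ⟨T, hT, fun ϑ hϑ => hmax hϑ⟩

/-- The increment from `θ` to a maximizer is nonnegative, so the linear score term must outweigh the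
quadratic loss. -/
lemma norm_sub_le_of_mem_argmaxSet_objective {A : Matrix (Fin (d + 1)) (Fin (d + 1)) ℝ} {c : ℝ}
    (hc : 0 < c)
    (hA : ∀ u : EuclideanSpace ℝ (Fin (d + 1)), c * ‖u‖ ^ 2 ≤ ∑ i, ∑ j, u i * A i j * u j)
    {n : ℕ} (hn : 1 ≤ n) {ω : Ω}
    (hB : ∑ i, ∑ j, |(n : ℝ)⁻¹ * M.gram n ω i j - A i j| ≤ c / 2)
    {S : Set (EuclideanSpace ℝ (Fin (d + 1)))} {θ T : EuclideanSpace ℝ (Fin (d + 1))} (hθ : θ ∈ S)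
    (hT : T ∈ argmaxSet (M.objective n ω) S) :
    ‖T - θ‖ ≤ 4 / c * ∑ i, |(n : ℝ)⁻¹ * M.score n ω θ i| := by
  have hn0 : (0 : ℝ) < n := by exact_mod_cast hn
  set G := ∑ i, |(n : ℝ)⁻¹ * M.score n ω θ i|
  have h := objective_add_le hA hn hB θ (T - θ)
  rw [add_sub_cancel] at h
  have h1 := hT.2 θ hθ
  by_contra! hlt
  rw [div_mul_eq_mul_div, div_lt_iff₀ hc] at hlt
  have hG : 0 ≤ G := Finset.sum_nonneg fun i _ => abs_nonneg _
  have hpos : 0 < ‖T - θ‖ := by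
    by_contra! h0
    nlinarith
  have h2 : ‖T - θ‖ * (G - c / 4 * ‖T - θ‖) < 0 := mul_neg_of_pos_of_neg hpos (by linarith)
  have h3 := mul_neg_of_pos_of_neg hn0 h2
  linarith

end RegressionModel

/-! ### Characteristic functions of normalized sums, and norm inequalities -/

lemma charFun_map_inv_sqrt_smul_sum {E Ω : Type*} [NormedAddCommGroup E] [InnerProductSpace ℝ E]
    [MeasurableSpace E] [BorelSpace E] [SecondCountableTopology E] [MeasurableSpace Ω]
    {μ : Measure Ω} {Z : ℕ → Ω → E} (hindep : iIndepFun Z μ)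
    (hident : ∀ t, IdentDistrib (Z t) (Z 0) μ μ) (n : ℕ) (u : E) :
    charFun (μ.map fun ω => (√(n : ℝ))⁻¹ • ∑ t ∈ Finset.range n, Z t ω) u
      = (∫ ω, Complex.exp (((√(n : ℝ))⁻¹ * inner ℝ (Z 0 ω) u : ℝ) * Complex.I) ∂μ) ^ n := by
  have hm : ∀ t, AEMeasurable (Z t) μ := fun t => (hident t).aemeasurable_fst
  rw [charFun_map_smul_comp (Finset.aemeasurable_fun_sum _ fun t _ => hm t),
    (hindep.restrict _).charFun_map_fun_finsetSum_eq_prod (fun t _ => hm t)]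
  simp only [Finset.prod_apply, fun t => (hident t).map_eq, Finset.prod_const, Finset.card_range]
  rw [charFun_apply, integral_map (hm 0) (by fun_prop)]
  simp only [inner_smul_right]

/-- Convexity of the `p`-th power. It passes moment bounds from the components of the score to their
linear combinations. -/
lemma abs_sum_mul_rpow_le {k : ℕ} {p : ℝ} (hp : 1 ≤ p) (u z : Fin k → ℝ) :
    |∑ i, u i * z i| ^ p ≤ (k : ℝ) ^ (p - 1) * ∑ i, |u i| ^ p * |z i| ^ p := by
  calc |∑ i, u i * z i| ^ p ≤ (∑ i, |u i * z i|) ^ p :=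
        Real.rpow_le_rpow (abs_nonneg _) (Finset.abs_sum_le_sum_abs _ _) (by linarith)
    _ ≤ (Finset.univ : Finset (Fin k)).card ^ (p - 1) * ∑ i, |u i * z i| ^ p :=
        Real.rpow_sum_le_const_mul_sum_rpow _ _ hp
    _ = _ := by
        simp only [Finset.card_univ, Fintype.card_fin, abs_mul,
          Real.mul_rpow (abs_nonneg _) (abs_nonneg _)]

lemma enorm_frobenius_le_ofReal_sum {k : ℕ} (A : Matrix (Fin k) (Fin k) ℝ) :
    ‖A‖ₑ ≤ ENNReal.ofReal (∑ i, ∑ j, |A i j|) := by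
  rw [← ofReal_norm]
  refine ENNReal.ofReal_le_ofReal ?_
  have h0 : (0 : ℝ) ≤ ∑ i, ∑ j, |A i j| := by positivity
  rw [Matrix.frobenius_norm_def, ← Real.sqrt_eq_rpow]
  refine Real.sqrt_le_iff.2 ⟨h0, ?_⟩
  have h2 : ∀ {ι : Type} (s : Finset ι) (f : ι → ℝ), (∀ i ∈ s, 0 ≤ f i) →
      ∑ i ∈ s, f i ^ 2 ≤ (∑ i ∈ s, f i) ^ 2 := fun s f hf => Finset.sum_sq_le_sq_sum_of_nonneg hf
  calc ∑ i, ∑ j, ‖A i j‖ ^ (2 : ℝ) = ∑ i, ∑ j, |A i j| ^ 2 := by simp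
    _ ≤ ∑ i, (∑ j, |A i j|) ^ 2 := Finset.sum_le_sum fun i _ => h2 _ _ fun j _ => abs_nonneg _
    _ ≤ _ := h2 _ _ fun i _ => Finset.sum_nonneg fun j _ => abs_nonneg _

/-! ### Limit theorems along drifting sequences -/

namespace RegressionModel

variable {d : ℕ} {Φ Ω : Type*} [MeasurableSpace Ω] {M : RegressionModel d Φ Ω}

lemma measurable_err (θ : EuclideanSpace ℝ (Fin (d + 1))) (t : ℕ) : Measurable (M.err θ t) := by
  have h1 := M.measurable_y t
  have h2 := M.measurable_x t
  unfold err
  fun_prop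

/-- The regressor is measurable for the conditioning σ-algebra and can be pulled out of the
conditional expectation of the error. -/
lemma integral_x_mul_err_eq_zero {μ : Measure Ω} [IsProbabilityMeasure μ]
    {θ : EuclideanSpace ℝ (Fin (d + 1))} {t : ℕ} (j : Fin (d + 1))
    (herr : Integrable (M.err θ t) μ)
    (hcond : μ[M.err θ t | MeasurableSpace.comap (M.x t) inferInstance] =ᵐ[μ] 0)
    (hint : Integrable (fun ω => M.x t ω j * M.err θ t ω) μ) :
    ∫ ω, M.x t ω j * M.err θ t ω ∂μ = 0 := by
  have hle : MeasurableSpace.comap (M.x t) inferInstance ≤ ‹MeasurableSpace Ω› :=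
    (M.measurable_x t).comap_le
  have hx : StronglyMeasurable[MeasurableSpace.comap (M.x t) inferInstance]
      fun ω => M.x t ω j := by
    refine Measurable.stronglyMeasurable ?_
    exact (by fun_prop : Measurable fun v : EuclideanSpace ℝ (Fin (d + 1)) => v j).comp
      (comap_measurable (M.x t))
  have h := condExp_mul_of_stronglyMeasurable_left hx
    (show Integrable ((fun ω => M.x t ω j) * M.err θ t) μ from hint) herr
  have h0 : μ[(fun ω => M.x t ω j) * M.err θ t | MeasurableSpace.comap (M.x t) inferInstance]
      =ᵐ[μ] 0 := by
    filter_upwards [h, hcond] with ω h1 h2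
    simp [h1, h2]
  have h1 := integral_condExp (μ := μ) hle (f := (fun ω => M.x t ω j) * M.err θ t)
  rw [integral_congr_ae h0] at h1
  simpa using h1.symm

section Drifting

variable {ψ : ℕ → EuclideanSpace ℝ (Fin (d + 1)) × Φ}
  {ψ₀ : EuclideanSpace ℝ (Fin (d + 1)) × Φ}

/-- Convergence along a drifting sequence of the expectations of continuous functions of the
regressors and the error, given uniform moment bounds. -/
lemma InducesWeakConvergence.tendsto_integral [TopologicalSpace Φ] (hΦ : M.InducesWeakConvergence)
    (hψ : ∀ n, ψ n ∈ M.fullParamSpace) (hψ₀ : ψ₀ ∈ M.fullParamSpace)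
    (hlim : Tendsto ψ atTop (𝓝 ψ₀)) (t : ℕ)
    {g : EuclideanSpace ℝ (Fin (d + 1)) × ℝ → ℝ} (hg : Continuous g) {δ C : ℝ} (hδ : 0 < δ)
    (hint : ∀ φ ∈ M.fullParamSpace,
      Integrable (fun ω => |g (M.x t ω, M.err φ.1 t ω)| ^ (1 + δ)) (M.P φ : Measure Ω))
    (hC : ∀ φ ∈ M.fullParamSpace,
      ∫ ω, |g (M.x t ω, M.err φ.1 t ω)| ^ (1 + δ) ∂(M.P φ : Measure Ω) ≤ C) :
    Tendsto (fun n => ∫ ω, g (M.x t ω, M.err (ψ n).1 t ω) ∂(M.P (ψ n) : Measure Ω)) atTop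
      (𝓝 (∫ ω, g (M.x t ω, M.err ψ₀.1 t ω) ∂(M.P ψ₀ : Measure Ω))) := by
  -- Only the marginal law of the observation at `t` is needed; the lag `1` is an arbitrary choice.
  have h1 := (hΦ ψ ψ₀ hψ hψ₀ hlim t 1 le_rfl).continuous_comp continuous_fst
  have h2 : TendstoInDistribution (fun n ω => g (M.x t ω, M.err (ψ n).1 t ω)) atTop
      (fun ω => g (M.x t ω, M.err ψ₀.1 t ω)) (fun n => (M.P (ψ n) : Measure Ω))
      (M.P ψ₀ : Measure Ω) :=
    -- The error is a continuous function of the observation and of the converging parameter `(ψ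
    -- n).1`.
    h1.continuous_comp_param ((continuous_fst.tendsto ψ₀).comp hlim)
      (g := fun p : (ℝ × EuclideanSpace ℝ (Fin (d + 1))) × EuclideanSpace ℝ (Fin (d + 1)) =>
        g (p.1.2, p.1.1 - ∑ i, p.2 i * p.1.2 i)) (by fun_prop)
  exact h2.tendsto_integral hδ (fun n => hint _ (hψ n)) (fun n => hC _ (hψ n)) (hint _ hψ₀)
    (hC _ hψ₀)

/-- Law of large numbers along a drifting sequence. -/
lemma InducesWeakConvergence.tendsto_integral_abs_average_sub [TopologicalSpace Φ]
    (hΦ : M.InducesWeakConvergence) {κ : ℝ} (hlin : M.LinIID κ)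
    (hψ : ∀ n, ψ n ∈ M.fullParamSpace) (hψ₀ : ψ₀ ∈ M.fullParamSpace)
    (hlim : Tendsto ψ atTop (𝓝 ψ₀))
    {g : EuclideanSpace ℝ (Fin (d + 1)) × ℝ → ℝ} (hg : Continuous g) {δ C : ℝ} (hδ : 0 < δ)
    (hint : ∀ φ ∈ M.fullParamSpace, ∀ t,
      Integrable (fun ω => |g (M.x t ω, M.err φ.1 t ω)| ^ (1 + δ)) (M.P φ : Measure Ω))
    (hC : ∀ φ ∈ M.fullParamSpace, ∀ t,
      ∫ ω, |g (M.x t ω, M.err φ.1 t ω)| ^ (1 + δ) ∂(M.P φ : Measure Ω) ≤ C) (s : ℕ) :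
    Tendsto (fun n : ℕ => ∫ ω, |(n : ℝ)⁻¹ * ∑ t ∈ Finset.range n,
        g (M.x t ω, M.err (ψ n).1 t ω) - ∫ ω', g (M.x s ω', M.err ψ₀.1 s ω') ∂(M.P ψ₀ : Measure Ω)|
          ∂(M.P (ψ n) : Measure Ω)) atTop (𝓝 0) := by
  have hid : ∀ φ ∈ M.fullParamSpace, ∀ t,
      IdentDistrib (fun ω => g (M.x t ω, M.err φ.1 t ω)) (fun ω => g (M.x 0 ω, M.err φ.1 0 ω))
        (M.P φ : Measure Ω) (M.P φ : Measure Ω) := fun φ hφ t =>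
    ((hlin.1 φ hφ).2.1 t).comp hg.measurable
  refine _root_.tendsto_integral_abs_average_sub
    (X := fun n t ω => g (M.x t ω, M.err (ψ n).1 t ω)) (fun n => ?_) (fun n t => hid _ (hψ n) t)
    hδ (fun n => hint _ (hψ n) 0) (fun n => hC _ (hψ n) 0) ?_
  · exact (hlin.1 _ (hψ n)).1.comp (fun _ => g) fun _ => hg.measurable
  · rw [(hid ψ₀ hψ₀ s).integral_eq]
    exact hΦ.tendsto_integral hψ hψ₀ hlim 0 hg hδ (fun φ hφ => hint φ hφ 0) fun φ hφ => hC φ hφ 0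

/-- The uniform moment bounds in terms of Bochner integrals. -/
lemma LinIID.exists_moment_bound {κ : ℝ} (hlin : M.LinIID κ) :
    ∃ C ν : ℝ, 0 < ν ∧ ∀ φ ∈ M.fullParamSpace, ∀ (t : ℕ) (j : Fin (d + 1)),
      (Integrable (fun ω => |M.x t ω j| ^ (2 + ν)) (M.P φ : Measure Ω) ∧
        ∫ ω, |M.x t ω j| ^ (2 + ν) ∂(M.P φ : Measure Ω) ≤ C) ∧
      (Integrable (fun ω => |M.x t ω j * M.err φ.1 t ω| ^ (2 + ν)) (M.P φ : Measure Ω) ∧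
        ∫ ω, |M.x t ω j * M.err φ.1 t ω| ^ (2 + ν) ∂(M.P φ : Measure Ω) ≤ C) := by
  obtain ⟨c, ν, hν, h⟩ := hlin.2.2
  refine ⟨max c 0, ν, hν, fun φ hφ t j => ?_⟩
  have hx := M.measurable_x t
  have he := measurable_err (M := M) φ.1 t
  have h1 : AEMeasurable (fun ω => M.x t ω j) (M.P φ : Measure Ω) := by fun_prop
  have h2 : AEMeasurable (fun ω => M.x t ω j * M.err φ.1 t ω) (M.P φ : Measure Ω) := by fun_prop
  exact ⟨⟨integrable_abs_rpow_of_lintegral_le h1 (h φ hφ t j).1,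
      integral_abs_rpow_le_of_lintegral_le h1 (h φ hφ t j).1⟩,
    integrable_abs_rpow_of_lintegral_le h2 (h φ hφ t j).2,
    integral_abs_rpow_le_of_lintegral_le h2 (h φ hφ t j).2⟩

lemma LinIID.integral_x_mul_err_eq_zero {κ : ℝ} (hlin : M.LinIID κ)
    {φ : EuclideanSpace ℝ (Fin (d + 1)) × Φ} (hφ : φ ∈ M.fullParamSpace) (t : ℕ)
    (j : Fin (d + 1)) : ∫ ω, M.x t ω j * M.err φ.1 t ω ∂(M.P φ : Measure Ω) = 0 := by
  obtain ⟨C, ν, hν, h⟩ := hlin.exists_moment_bound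
  have hx := M.measurable_x t
  have he := measurable_err (M := M) φ.1 t
  exact RegressionModel.integral_x_mul_err_eq_zero j ((hlin.1 φ hφ).2.2 t).1
    ((hlin.1 φ hφ).2.2 t).2
    (integrable_of_integrable_abs_rpow (by fun_prop) (by linarith) (h φ hφ t j).2.1)

lemma InducesWeakConvergence.tendsto_integral_gram [TopologicalSpace Φ]
    (hΦ : M.InducesWeakConvergence) {κ : ℝ} (hlin : M.LinIID κ)
    (hψ : ∀ n, ψ n ∈ M.fullParamSpace) (hψ₀ : ψ₀ ∈ M.fullParamSpace)
    (hlim : Tendsto ψ atTop (𝓝 ψ₀)) (s : ℕ) (i j : Fin (d + 1)) :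
    Tendsto (fun n : ℕ => ∫ ω, |(n : ℝ)⁻¹ * M.gram n ω i j - M.regressorMoment ψ₀ s i j|
      ∂(M.P (ψ n) : Measure Ω)) atTop (𝓝 0) := by
  obtain ⟨C, ν, hν, h⟩ := hlin.exists_moment_bound
  have hx : ∀ t (φ : EuclideanSpace ℝ (Fin (d + 1)) × Φ) (k : Fin (d + 1)),
      AEMeasurable (fun ω => M.x t ω k) (M.P φ : Measure Ω) := fun t φ k => by
    have := M.measurable_x t
    fun_prop
  have he : (2 + ν) / 2 = 1 + ν / 2 := by ring
  refine hΦ.tendsto_integral_abs_average_sub hlin hψ hψ₀ hlim (g := fun p => p.1 i * p.1 j)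
    (by fun_prop) (half_pos hν) (C := C) (fun φ hφ t => ?_) (fun φ hφ t => ?_) s
  · rw [← he]
    exact integrable_abs_mul_rpow_half (hx t φ i) (hx t φ j) (h φ hφ t i).1.1 (h φ hφ t j).1.1
  · rw [← he]
    exact integral_abs_mul_rpow_half_le (hx t φ i) (hx t φ j) (h φ hφ t i).1.1 (h φ hφ t j).1.1
      (h φ hφ t i).1.2 (h φ hφ t j).1.2

/-- The law of large numbers with exponent `1 + (1 + ν)`; the limit is zero because regressors and
errors are orthogonal under `ψ₀`. -/
lemma InducesWeakConvergence.tendsto_integral_score [TopologicalSpace Φ]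
    (hΦ : M.InducesWeakConvergence) {κ : ℝ} (hlin : M.LinIID κ)
    (hψ : ∀ n, ψ n ∈ M.fullParamSpace) (hψ₀ : ψ₀ ∈ M.fullParamSpace)
    (hlim : Tendsto ψ atTop (𝓝 ψ₀)) (i : Fin (d + 1)) :
    Tendsto (fun n : ℕ => ∫ ω, |(n : ℝ)⁻¹ * M.score n ω (ψ n).1 i| ∂(M.P (ψ n) : Measure Ω))
      atTop (𝓝 0) := by
  obtain ⟨C, ν, hν, h⟩ := hlin.exists_moment_bound
  have he : 2 + ν = 1 + (1 + ν) := by ring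
  rw [he] at h
  have := hΦ.tendsto_integral_abs_average_sub hlin hψ hψ₀ hlim (g := fun p => p.1 i * p.2)
    (by fun_prop) (by positivity) (C := C) (fun φ hφ t => (h φ hφ t i).2.1)
    (fun φ hφ t => (h φ hφ t i).2.2) 0
  rw [hlin.integral_x_mul_err_eq_zero hψ₀ 0 i] at this
  simp only [sub_zero] at this
  exact this

lemma InducesWeakConvergence.tendsto_scoreMoment [TopologicalSpace Φ]
    (hΦ : M.InducesWeakConvergence) {κ : ℝ} (hlin : M.LinIID κ)
    (hψ : ∀ n, ψ n ∈ M.fullParamSpace) (hψ₀ : ψ₀ ∈ M.fullParamSpace)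
    (hlim : Tendsto ψ atTop (𝓝 ψ₀)) (t : ℕ) (i j : Fin (d + 1)) :
    Tendsto (fun n : ℕ => M.scoreMoment (ψ n) t i j) atTop (𝓝 (M.scoreMoment ψ₀ t i j)) := by
  obtain ⟨C, ν, hν, h⟩ := hlin.exists_moment_bound
  have hx : ∀ (φ : EuclideanSpace ℝ (Fin (d + 1)) × Φ) (k : Fin (d + 1)),
      AEMeasurable (fun ω => M.x t ω k * M.err φ.1 t ω) (M.P φ : Measure Ω) := fun φ k => by
    have := M.measurable_x t
    have := measurable_err (M := M) φ.1 t
    fun_prop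
  have he : (2 + ν) / 2 = 1 + ν / 2 := by ring
  have hsplit : ∀ (φ : EuclideanSpace ℝ (Fin (d + 1)) × Φ) ω,
      M.x t ω i * M.x t ω j * M.err φ.1 t ω ^ 2
        = (M.x t ω i * M.err φ.1 t ω) * (M.x t ω j * M.err φ.1 t ω) := fun φ ω => by ring
  refine hΦ.tendsto_integral hψ hψ₀ hlim t (g := fun p => p.1 i * p.1 j * p.2 ^ 2)
    (by fun_prop) (half_pos hν) (C := C) (fun φ hφ => ?_) (fun φ hφ => ?_)
  · simp only [hsplit]
    rw [← he]
    exact integrable_abs_mul_rpow_half (hx φ i) (hx φ j) (h φ hφ t i).2.1 (h φ hφ t j).2.1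
  · simp only [hsplit]
    rw [← he]
    exact integral_abs_mul_rpow_half_le (hx φ i) (hx φ j) (h φ hφ t i).2.1 (h φ hφ t j).2.1
      (h φ hφ t i).2.2 (h φ hφ t j).2.2

lemma LinIID.integrable_gram {κ : ℝ} (hlin : M.LinIID κ)
    {φ : EuclideanSpace ℝ (Fin (d + 1)) × Φ} (hφ : φ ∈ M.fullParamSpace) (n : ℕ)
    (i j : Fin (d + 1)) : Integrable (fun ω => M.gram n ω i j) (M.P φ : Measure Ω) := by
  obtain ⟨C, ν, hν, h⟩ := hlin.exists_moment_bound
  simp only [gram, Matrix.of_apply]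
  refine integrable_finsetSum _ fun t _ => ?_
  have := M.measurable_x t
  exact integrable_of_integrable_abs_rpow (by fun_prop) (by linarith)
    (integrable_abs_mul_rpow_half (by fun_prop) (by fun_prop) (h φ hφ t i).1.1 (h φ hφ t j).1.1)

lemma LinIID.integrable_score {κ : ℝ} (hlin : M.LinIID κ)
    {φ : EuclideanSpace ℝ (Fin (d + 1)) × Φ} (hφ : φ ∈ M.fullParamSpace) (n : ℕ)
    (i : Fin (d + 1)) : Integrable (fun ω => M.score n ω φ.1 i) (M.P φ : Measure Ω) := by
  obtain ⟨C, ν, hν, h⟩ := hlin.exists_moment_bound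
  simp only [score]
  refine integrable_finsetSum _ fun t _ => ?_
  have := M.measurable_x t
  have := measurable_err (M := M) φ.1 t
  exact integrable_of_integrable_abs_rpow (by fun_prop) (by linarith) (h φ hφ t i).2.1

lemma tendstoZeroInProbability_gram [TopologicalSpace Φ]
    (hΦ : M.InducesWeakConvergence) {κ : ℝ} (hlin : M.LinIID κ)
    (hψ : ∀ n, ψ n ∈ M.fullParamSpace) (hψ₀ : ψ₀ ∈ M.fullParamSpace)
    (hlim : Tendsto ψ atTop (𝓝 ψ₀)) (s : ℕ) :
    TendstoZeroInProbability (fun n => (M.P (ψ n) : Measure Ω)) fun n ω => ENNReal.ofReal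
      (∑ i, ∑ j, |(n : ℝ)⁻¹ * M.gram n ω i j - M.regressorMoment ψ₀ s i j|) := by
  have hint : ∀ (n : ℕ) i j, Integrable
      (fun ω => |(n : ℝ)⁻¹ * M.gram n ω i j - M.regressorMoment ψ₀ s i j|)
      (M.P (ψ n) : Measure Ω) := fun n i j =>
    (((hlin.integrable_gram (hψ n) n i j).const_mul _).sub (integrable_const _)).abs
  refine tendstoZeroInProbability_of_tendsto_integral
    (fun n => integrable_finsetSum _ fun i _ => integrable_finsetSum _ fun j _ => hint n i j)
    (fun n ω => by positivity) ?_
  have h := tendsto_finsetSum (Finset.univ : Finset (Fin (d + 1))) fun i _ =>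
    tendsto_finsetSum (Finset.univ : Finset (Fin (d + 1))) fun j _ =>
      hΦ.tendsto_integral_gram hlin hψ hψ₀ hlim s i j
  simp only [Finset.sum_const_zero] at h
  refine h.congr fun n => ?_
  rw [integral_finsetSum _ fun i _ => integrable_finsetSum _ fun j _ => hint n i j]
  exact Finset.sum_congr rfl fun i _ => (integral_finsetSum _ fun j _ => hint n i j).symm

lemma tendstoZeroInProbability_score [TopologicalSpace Φ]
    (hΦ : M.InducesWeakConvergence) {κ : ℝ} (hlin : M.LinIID κ)
    (hψ : ∀ n, ψ n ∈ M.fullParamSpace) (hψ₀ : ψ₀ ∈ M.fullParamSpace)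
    (hlim : Tendsto ψ atTop (𝓝 ψ₀)) {a : ℝ} (ha : 0 ≤ a) :
    TendstoZeroInProbability (fun n => (M.P (ψ n) : Measure Ω)) fun n ω => ENNReal.ofReal
      (a * ∑ i, |(n : ℝ)⁻¹ * M.score n ω (ψ n).1 i|) := by
  have hint : ∀ (n : ℕ) i, Integrable (fun ω => |(n : ℝ)⁻¹ * M.score n ω (ψ n).1 i|)
      (M.P (ψ n) : Measure Ω) := fun n i =>
    ((hlin.integrable_score (hψ n) n i).const_mul _).abs
  refine tendstoZeroInProbability_of_tendsto_integral
    (fun n => (integrable_finsetSum _ fun i _ => hint n i).const_mul _)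
    (fun n ω => by positivity) ?_
  have h := (tendsto_finsetSum (Finset.univ : Finset (Fin (d + 1))) fun i _ =>
    hΦ.tendsto_integral_score hlin hψ hψ₀ hlim i).const_mul a
  simp only [Finset.sum_const_zero, mul_zero] at h
  refine h.congr fun n => ?_
  rw [integral_const_mul, integral_finsetSum _ fun i _ => hint n i]

/-- A maximum estimator over a closed set that contains the true parameters is consistent. -/
lemma tendstoZeroInProbability_maximumEstimator_sub [TopologicalSpace Φ]
    (hΦ : M.InducesWeakConvergence) {κ : ℝ} (hlin : M.LinIID κ)
    (hψ : ∀ n, ψ n ∈ M.fullParamSpace) (hψ₀ : ψ₀ ∈ M.fullParamSpace)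
    (hlim : Tendsto ψ atTop (𝓝 ψ₀)) {S : Set (EuclideanSpace ℝ (Fin (d + 1)))} (hS : IsClosed S)
    (hψS : ∀ n, (ψ n).1 ∈ S) {T : ℕ → Ω → EuclideanSpace ℝ (Fin (d + 1))}
    (hT : IsMaximumEstimator M.objective S T) :
    TendstoZeroInProbability (fun n => (M.P (ψ n) : Measure Ω))
      fun n ω => ‖T n ω - (ψ n).1‖ₑ := by
  -- The constant comes from the limiting regressor moment, so it is the same for all `n`. Where the
  -- Gram error is below `c / 2`, a maximizer exists, so `T n ω` is one.
  obtain ⟨c, hc, hA⟩ := (hlin.2.1 ψ₀ hψ₀ 0).1.1.exists_pos_mul_norm_sq_le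
  refine (tendstoZeroInProbability_score hΦ hlin hψ hψ₀ hlim (a := 4 / c)
    (by positivity)).of_le_of_lt (tendstoZeroInProbability_gram hΦ hlin hψ hψ₀ hlim 0)
    (a := ENNReal.ofReal (c / 2)) (by simpa using hc) ?_
  filter_upwards [eventually_ge_atTop 1] with n hn ω hω
  have hB := ((ENNReal.ofReal_lt_ofReal_iff (half_pos hc)).1 hω).le
  have hmax := hT n ω (exists_mem_argmaxSet_objective hc hA hn hB hS ⟨_, hψS n⟩)
  rw [← ofReal_norm]
  exact ENNReal.ofReal_le_ofReal
    (norm_sub_le_of_mem_argmaxSet_objective hc hA hn hB (hψS n) hmax)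

/-! ### Asymptotic normality of the score -/

lemma lrGradient_objective (n : ℕ) (ω : Ω) {θ : EuclideanSpace ℝ (Fin (d + 1))}
    (hθ : θ ∈ paramSpace d) :
    lrGradient (paramSpace d) (M.objective n ω) θ
      = ∑ t ∈ Finset.range n, M.err θ t ω • M.x t ω := by
  ext i
  simp [lrGradient, lrPartial_objective n ω i hθ, score, mul_comm]

/-- Characteristic function of a linear combination of the components of the score. -/
lemma InducesWeakConvergence.tendsto_integral_exp_score [TopologicalSpace Φ]
    (hΦ : M.InducesWeakConvergence) {κ : ℝ} (hlin : M.LinIID κ)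
    (hψ : ∀ n, ψ n ∈ M.fullParamSpace) (hψ₀ : ψ₀ ∈ M.fullParamSpace)
    (hlim : Tendsto ψ atTop (𝓝 ψ₀)) (u : EuclideanSpace ℝ (Fin (d + 1))) :
    Tendsto (fun n : ℕ => (∫ ω, Complex.exp (((√(n : ℝ))⁻¹ *
        inner ℝ (M.err (ψ n).1 0 ω • M.x 0 ω) u : ℝ) * Complex.I) ∂(M.P (ψ n) : Measure Ω)) ^ n)
      atTop (𝓝 (Complex.exp (-(∑ i, ∑ j, u i * u j * M.scoreMoment ψ₀ 0 i j : ℝ) / 2))) := by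
  obtain ⟨C, ν, hν, h⟩ := hlin.exists_moment_bound
  have hxm := M.measurable_x 0
  have hinner : ∀ (θ : EuclideanSpace ℝ (Fin (d + 1))) ω, inner ℝ (M.err θ 0 ω • M.x 0 ω) u
      = ∑ i, u i * (M.x 0 ω i * M.err θ 0 ω) := fun θ ω => by
    simp only [PiLp.inner_apply, PiLp.smul_apply, smul_eq_mul, RCLike.inner_apply, conj_trivial]
    exact Finset.sum_congr rfl fun i _ => by ring
  simp only [hinner]
  have hz : ∀ n i, AEMeasurable (fun ω => M.x 0 ω i * M.err (ψ n).1 0 ω)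
      (M.P (ψ n) : Measure Ω) := fun n i => by
    have := measurable_err (M := M) (ψ n).1 0
    fun_prop
  have hz1 : ∀ n i, Integrable (fun ω => M.x 0 ω i * M.err (ψ n).1 0 ω)
      (M.P (ψ n) : Measure Ω) := fun n i =>
    integrable_of_integrable_abs_rpow (hz n i) (by linarith) (h _ (hψ n) 0 i).2.1
  have hz2 : ∀ n i j, Integrable (fun ω => (M.x 0 ω i * M.err (ψ n).1 0 ω) *
      (M.x 0 ω j * M.err (ψ n).1 0 ω)) (M.P (ψ n) : Measure Ω) := fun n i j =>
    integrable_of_integrable_abs_rpow ((hz n i).mul (hz n j)) (by linarith)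
      (integrable_abs_mul_rpow_half (hz n i) (hz n j) (h _ (hψ n) 0 i).2.1 (h _ (hψ n) 0 j).2.1)
  have hY : ∀ n, AEMeasurable (fun ω => ∑ i, u i * (M.x 0 ω i * M.err (ψ n).1 0 ω))
      (M.P (ψ n) : Measure Ω) := fun n =>
    Finset.aemeasurable_fun_sum _ fun i _ => (hz n i).const_mul _
  have hdom : ∀ n, Integrable (fun ω => ((d + 1 : ℕ) : ℝ) ^ (2 + ν - 1) *
      ∑ i, |u i| ^ (2 + ν) * |M.x 0 ω i * M.err (ψ n).1 0 ω| ^ (2 + ν))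
      (M.P (ψ n) : Measure Ω) := fun n =>
    (integrable_finsetSum _ fun i _ => (h _ (hψ n) 0 i).2.1.const_mul _).const_mul _
  have hle : ∀ n ω, |∑ i, u i * (M.x 0 ω i * M.err (ψ n).1 0 ω)| ^ (2 + ν)
      ≤ ((d + 1 : ℕ) : ℝ) ^ (2 + ν - 1) *
        ∑ i, |u i| ^ (2 + ν) * |M.x 0 ω i * M.err (ψ n).1 0 ω| ^ (2 + ν) := fun n ω =>
    abs_sum_mul_rpow_le (by linarith) _ _
  have hYν : ∀ n, Integrable (fun ω => |∑ i, u i * (M.x 0 ω i * M.err (ψ n).1 0 ω)| ^ (2 + ν))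
      (M.P (ψ n) : Measure Ω) := fun n => by
    refine (hdom n).mono' ((hY n).abs.pow_const _).aestronglyMeasurable (ae_of_all _ fun ω => ?_)
    rw [Real.norm_of_nonneg (by positivity)]
    exact hle n ω
  refine tendsto_integral_exp_pow hY hν hYν
    (C := ((d + 1 : ℕ) : ℝ) ^ (2 + ν - 1) * ∑ i, |u i| ^ (2 + ν) * C) (fun n => ?_)
    (fun n => ?_) ?_
  · refine (integral_mono (hYν n) (hdom n) (hle n)).trans ?_
    rw [integral_const_mul, integral_finsetSum _ fun i _ => (h _ (hψ n) 0 i).2.1.const_mul _]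
    simp only [integral_const_mul]
    gcongr with i
    exact (h _ (hψ n) 0 i).2.2
  · rw [integral_finsetSum _ fun i _ => (hz1 n i).const_mul _]
    simp only [integral_const_mul, hlin.integral_x_mul_err_eq_zero (hψ n), mul_zero,
      Finset.sum_const_zero]
  -- The second moment of the linear combination is the quadratic form of the score moment matrix at
  -- `u`, which converges entrywise.
  · have hsum := tendsto_finsetSum (Finset.univ : Finset (Fin (d + 1))) fun i _ =>
      tendsto_finsetSum (Finset.univ : Finset (Fin (d + 1))) fun j _ =>
        (hΦ.tendsto_scoreMoment hlin hψ hψ₀ hlim 0 i j).const_mul (u i * u j)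
    refine hsum.congr fun n => ?_
    have hsq : ∀ ω, (∑ i, u i * (M.x 0 ω i * M.err (ψ n).1 0 ω)) ^ 2
        = ∑ i, ∑ j, u i * u j * ((M.x 0 ω i * M.err (ψ n).1 0 ω) *
          (M.x 0 ω j * M.err (ψ n).1 0 ω)) := fun ω => by
      rw [sq, Finset.sum_mul_sum]
      exact Finset.sum_congr rfl fun i _ => Finset.sum_congr rfl fun j _ => by ring
    simp only [hsq]
    rw [integral_finsetSum _ fun i _ => integrable_finsetSum _ fun j _ => (hz2 n i j).const_mul _]
    refine Finset.sum_congr rfl fun i _ => ?_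
    rw [integral_finsetSum _ fun j _ => (hz2 n i j).const_mul _]
    refine Finset.sum_congr rfl fun j _ => ?_
    rw [integral_const_mul]
    congr 1
    exact integral_congr_ae (ae_of_all _ fun ω => by ring)

lemma LinIID.scoreMoment_eq {κ : ℝ} (hlin : M.LinIID κ)
    {φ : EuclideanSpace ℝ (Fin (d + 1)) × Φ} (hφ : φ ∈ M.fullParamSpace) (t : ℕ) :
    M.scoreMoment φ t = M.scoreMoment φ 0 := by
  ext i j
  exact (((hlin.1 φ hφ).2.1 t).comp (u := fun p : EuclideanSpace ℝ (Fin (d + 1)) × ℝ =>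
    p.1 i * p.1 j * p.2 ^ 2) (by fun_prop)).integral_eq

/-- By Lévy's continuity theorem it is enough to compare characteristic functions. That of the
normalized sum is an `n`-th power, to which the scalar limit theorem applies for each `u`. -/
lemma tendstoInDistribution_score [TopologicalSpace Φ]
    (hΦ : M.InducesWeakConvergence) {κ : ℝ} (hlin : M.LinIID κ)
    (hψ : ∀ n, ψ n ∈ M.fullParamSpace) (hψ₀ : ψ₀ ∈ M.fullParamSpace)
    (hlim : Tendsto ψ atTop (𝓝 ψ₀)) (t : ℕ) :
    TendstoInDistribution
      (fun (n : ℕ) ω => (√(n : ℝ))⁻¹ • ∑ t ∈ Finset.range n, M.err (ψ n).1 t ω • M.x t ω) atTop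
      (id : EuclideanSpace ℝ (Fin (d + 1)) → EuclideanSpace ℝ (Fin (d + 1)))
      (fun n => (M.P (ψ n) : Measure Ω)) (multivariateGaussian 0 (M.scoreMoment ψ₀ t)) := by
  rw [hlin.scoreMoment_eq hψ₀ t]
  refine ⟨fun n => ?_, aemeasurable_id, ?_⟩
  · have h1 := fun t => measurable_err (M := M) (ψ n).1 t
    have h2 := M.measurable_x
    fun_prop
  · refine ProbabilityMeasure.tendsto_iff_tendsto_charFun.2 fun u => ?_
    have hg : Measurable fun p : EuclideanSpace ℝ (Fin (d + 1)) × ℝ => p.2 • p.1 := by fun_prop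
    have hn : ∀ n, charFun ((M.P (ψ n) : Measure Ω).map fun ω => (√(n : ℝ))⁻¹ •
        ∑ t ∈ Finset.range n, M.err (ψ n).1 t ω • M.x t ω) u = _ := fun n =>
      charFun_map_inv_sqrt_smul_sum ((hlin.1 _ (hψ n)).1.comp (fun _ p => p.2 • p.1) fun _ => hg)
        (fun t => ((hlin.1 _ (hψ n)).2.1 t).comp hg) n u
    simp only [ProbabilityMeasure.coe_mk, Measure.map_id]
    rw [charFun_multivariateGaussian (hlin.2.1 ψ₀ hψ₀ 0).2.1.posSemidef]
    have h := hΦ.tendsto_integral_exp_score hlin hψ hψ₀ hlim u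
    convert! h using 1
    · ext n
      exact hn n
    · congr 2
      simp only [inner_zero_right, Complex.ofReal_zero, zero_mul, zero_sub, neg_div]
      congr 3
      simp only [dotProduct, Matrix.mulVec, Finset.mul_sum]
      exact Finset.sum_congr rfl fun i _ => Finset.sum_congr rfl fun j _ => by ring

end Drifting

end RegressionModel

/-! ### The four conditions along the drifting sequence -/

theorem proposition1 {d : ℕ} {Φ Ω : Type*} [MetricSpace Φ] [CompactSpace Φ] [MeasurableSpace Ω]
    (M : RegressionModel d Φ Ω) (hΦ : M.InducesWeakConvergence)
    (κ : ℝ) (hκ : 0 < κ) (hlin : M.LinIID κ)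
    (ψ : ℕ → EuclideanSpace ℝ (Fin (d + 1)) × Φ) (ψ₀ : EuclideanSpace ℝ (Fin (d + 1)) × Φ)
    (b : Fin d → ℝ≥0∞) (hψ : M.IsDrifting ψ ψ₀ b) (t : ℕ) :
    ConsistencyCondition (fun n => (M.P (ψ n) : Measure Ω)) M.objective
      (paramSpace d) (nullParamSpace d) (fun n => (ψ n).1) ∧
    DerivativesCondition (fun n => (M.P (ψ n) : Measure Ω)) M.objective
      (paramSpace d) (fun n => (ψ n).1) ∧
    HessianCondition (fun n => (M.P (ψ n) : Measure Ω)) M.objective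
      (paramSpace d) (fun n => (ψ n).1) (boundedPosDef (d + 1) κ) (M.regressorMoment ψ₀ t) ∧
    ScoreCondition (fun n => M.P (ψ n)) M.objective
      (paramSpace d) (fun n => (ψ n).1) (boundedPosDef (d + 1) κ) (M.scoreMoment ψ₀ t) := by
  have hfull : ∀ n, ψ n ∈ M.fullParamSpace := fun n => (hψ.1 n).1
  have hnull : ∀ n, (ψ n).1 ∈ nullParamSpace d := fun n => (hψ.1 n).2
  have hΘ : ∀ n, (ψ n).1 ∈ paramSpace d := fun n => (hnull n).1
  obtain ⟨-, hψ₀, hlim, -⟩ := hψ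
  refine ⟨⟨fun T hT => ?_, fun T hT => ?_⟩, ⟨fun n _ => ae_of_all _ fun ω => ?_, fun r _ => ?_⟩,
    ⟨?_, (hlin.2.1 ψ₀ hψ₀ t).1⟩, ⟨?_, (hlin.2.1 ψ₀ hψ₀ t).2⟩⟩
  · exact RegressionModel.tendstoZeroInProbability_maximumEstimator_sub hΦ hlin hfull hψ₀ hlim
      (isClosed_paramSpace d) hΘ hT
  · exact RegressionModel.tendstoZeroInProbability_maximumEstimator_sub hΦ hlin hfull hψ₀ hlim
      (isClosed_nullParamSpace d) hnull hT
  · exact RegressionModel.hasContinuousLRPartialsTwo_objective n ω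
  -- The Hessian is constant on the parameter space, so the supremum is zero; any sequence known to
  -- be `o_p(1)` serves as a bound.
  · refine (RegressionModel.tendstoZeroInProbability_gram hΦ hlin hfull hψ₀ hlim t).of_le
      fun n ω => ?_
    refine iSup₂_le fun ϑ hϑ => ?_
    rw [RegressionModel.lrHessian_objective n ω hϑ.1,
      RegressionModel.lrHessian_objective n ω (hΘ n), ← ofReal_norm, sub_self, norm_zero,
      ENNReal.ofReal_zero]
    exact zero_le
  · refine (RegressionModel.tendstoZeroInProbability_gram hΦ hlin hfull hψ₀ hlim t).of_le
      fun n ω => ?_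
    rw [RegressionModel.lrHessian_objective n ω (hΘ n), smul_neg, ← neg_sub', enorm_neg]
    exact enorm_frobenius_le_ofReal_sum _
  · have hgrad : (fun (n : ℕ) ω =>
        (√(n : ℝ))⁻¹ • lrGradient (paramSpace d) (M.objective n ω) (ψ n).1) =
        fun (n : ℕ) ω => (√(n : ℝ))⁻¹ • ∑ t ∈ Finset.range n, M.err (ψ n).1 t ω • M.x t ω := by
      ext1 n
      ext1 ω
      rw [RegressionModel.lrGradient_objective n ω (hΘ n)]
    rw [hgrad]
    exact RegressionModel.tendstoInDistribution_score hΦ hlin hfull hψ₀ hlim t
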